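/- **Definitions.** Let $G$ be a group and $M\subseteq G$ a submonoid with $M\cap M^{-1}=\{1\}$. Write $\alpha\le_R\beta$ if $\beta\alpha^{-1}\in M$ and $\alpha\le_L\beta$ if $\alpha^{-1}\beta\in M$. An element $a\in M$ is *balanced* if $\{b\in M: b\le_R a\}=\{b\in M: b\le_L a\}$; this set is then denoted $\mathrm{Div}(a)$. For $\Delta\in M$ balanced, $(G,M,\Delta)$ is a *Garside structure* if (a) for every $a\in M$ there is $n\ge1$ such that $a$ is not a product of more than $n$ non-trivial elements of $M$; (b) $\mathrm{Div}(\Delta)$ is finite and generates $M$ as a monoid and $G$ as a group; (c) $(G,\le_R)$ is a lattice. For $\delta\in M$ balanced, let $G_\delta$ and $M_\delta$ be the subgroup and the submonoid generated by $\mathrm{Div}(\delta)$; $(G_\delta,M_\delta,\delta)$ is a *parabolic substructure* if $\mathrm{Div}(\delta)=\mathrm{Div}(\Delta)\cap M_\delta$. Let $(G,M,\Delta)$ be a Garside structure with parabolic substructures $(H,N,\Lambda)$, $(G_1,M_1,\Delta_1)$ such that $N\ne M$, $M_1\neq M$, $N\cup M_1$ generates $M$, $\Delta$ is central in $G$ and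 $\Delta_1$ is central in $G_1$ (call this an *admissible pair*). An element $a\in M$ is *unmovable* if $\Delta\not\le_R a$; every $\alpha\in G$ is uniquely $\alpha=a\Delta^{n}$ with $a\in M$ unmovable and $n\in\mathbb Z$ (its *$\Delta$-form*). The *$N$-tail* of $a\in M$ is the unique $b\in N$ with $\{c\in N: c\le_R a\}=\{c\in N: c\le_R b\}$, and similarly for $M_1$. Every $a\in M\setminus\{1\}$ is uniquely $a=a_p\cdots a_2a_1$ with $a_p\ne1$, where $a_i$ is the $M_1$-tail (for $i$ odd), resp. the $N$-tail (for $i$ even), of $a_p\cdots a_i$. Put $\mathrm{dpt}(a)=\lfloor p/2\rfloor$ and $\mathrm{dpt}(1)=0$. Let $\theta=\Delta\Delta_1^{-1}$, $\Theta=\{\theta^n a_0: n\ge1,\ a_0\in M_1\}$ and $\bar\Theta=\Theta\cup M_1$. For an integer $\zeta\ge1$: * *Condition A with constant $\zeta$*: $\mathrm{dpt}(\Delta^n)=\zeta n+1$ for all $n\ge1$. * *Condition B with constant $\zeta$*: for all unmovable $a,b\in M$ with $(a,b)\notin\bar\Theta\times\bar\Theta$, if $ab=c\Delta^r$ is the $\Delta$-form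 of $ab$, there is $\varepsilon\in\{0,1\}$ with $\mathrm{dpt}(c)=\mathrm{dpt}(a)+\mathrm{dpt}(b)-\zeta r-\varepsilon$, and $\varepsilon=1$ whenever $a\in\Theta$, or $b\in\Theta$, or $c\in M_1$. An element with $\Delta$-form $a\Delta^{-n}$ is *$(H,G_1)$-negative* if $n\ge1$ and $\mathrm{dpt}(a)<\mathrm{dpt}(\Delta^n)$; an element is *$(H,G_1)$-positive* if its inverse is negative. Let $P$ be the set of positive elements. The pair $(H,G_1)$ is a *Dehornoy structure* on $G$ if $PP\subseteq P$, $G_1PG_1\subseteq P$, and $G$ is the disjoint union of $P$, $P^{-1}$ and $G_1$. A set $Q\subseteq G$ is the *positive cone of a left-order* if there is a strict total order $<$ on $G$, invariant under left multiplication, with $\alpha<\beta\iff\alpha^{-1}\beta\in Q$. **Theorem.** Let $k\ge2$, let $m=2k$, and let $G=\langle s,t\mid (st)^k=(ts)^k\rangle$ be the Artin group of type $I_2(m)$. Let $M$ be the submonoid of $G$ generated by $s,t$, and let $\Delta=(st)^k$. Let $H$ and $N$ be the subgroup and the submonoid generated by $\Lambda=s$, and let $G_1$ and $M_1$ be the subgroup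 and the submonoid generated by $\Delta_1=t$. Then: 1. $(G,M,\Delta)$ is a Garside structure, and $(H,N,\Lambda)$, $(G_1,M_1,\Delta_1)$ are parabolic substructures forming an admissible pair; 2. $(H,G_1)$ satisfies Condition A and Condition B with constant $\zeta=k-1$; 3. $(H,G_1)$ is a Dehornoy structure on $G$; 4. if $P_1$ is the set of $(H,G_1)$-positive elements and $P_2=\{t^n: n\ge1\}$, then for all $\epsilon_1,\epsilon_2\in\{1,-1\}$ the set $P_1^{\epsilon_1}\cup P_2^{\epsilon_2}$ is the positive cone of a left-order on $G$. -/

import Mathlib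

namespace DehornoyStructures

section General

variable {G : Type*} [Group G]

/-- `α ≤_R β` with respect to `M`. -/
def LeR (M : Submonoid G) (α β : G) : Prop := β * α⁻¹ ∈ M

/-- `α ≤_L β` with respect to `M`. -/
def LeL (M : Submonoid G) (α β : G) : Prop := α⁻¹ * β ∈ M

/-- The right divisors in `M` of `a`. -/
def DivR (M : Submonoid G) (a : G) : Set G := {b | b ∈ M ∧ LeR M b a}

/-- The left divisors in `M` of `a`. -/
def DivL (M : Submonoid G) (a : G) : Set G := {b | b ∈ M ∧ LeL M b a}

/-- `a` is a balanced element of `M`; then `Div(a)` is `DivR M a = DivL M a`. -/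
def IsBalanced (M : Submonoid G) (a : G) : Prop := a ∈ M ∧ DivR M a = DivL M a

/-- `M` is Noetherian: each element of `M` has a bound on the number of factors in its
factorizations into non-trivial elements of `M`. -/
def IsNoetherianMonoid (M : Submonoid G) : Prop :=
  ∀ a ∈ M, ∃ n : ℕ, 1 ≤ n ∧
    ∀ l : List G, (∀ x ∈ l, x ∈ M ∧ x ≠ 1) → l.prod = a → l.length ≤ n

/-- `(G, ≤_R)` is a lattice: any two elements have a greatest lower bound and a least upper
bound. (It is a partial order as soon as `M ∩ M⁻¹ = {1}`.) -/
def IsLatticeR (M : Submonoid G) : Prop :=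
  ∀ α β : G,
    (∃ γ, LeR M γ α ∧ LeR M γ β ∧ ∀ δ, LeR M δ α → LeR M δ β → LeR M δ γ) ∧
    (∃ γ, LeR M α γ ∧ LeR M β γ ∧ ∀ δ, LeR M α δ → LeR M β δ → LeR M γ δ)

/-- `(G, M, Δ)` is a Garside structure on `G`. -/
structure IsGarsideStructure (M : Submonoid G) (Δ : G) : Prop where
  eq_one_of_mem_of_inv_mem : ∀ a ∈ M, a⁻¹ ∈ M → a = 1
  balanced : IsBalanced M Δ
  noetherian : IsNoetherianMonoid M
  finite_div : (DivR M Δ).Finite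
  closure_div : Submonoid.closure (DivR M Δ) = M
  group_closure_div : Subgroup.closure (DivR M Δ) = ⊤
  lattice : IsLatticeR M

/-- `(K, N, δ)` is a parabolic substructure of `(G, M, Δ)`. -/
structure IsParabolicSubstructure (M : Submonoid G) (Δ : G)
    (K : Subgroup G) (N : Submonoid G) (δ : G) : Prop where
  balanced : IsBalanced M δ
  group_eq : K = Subgroup.closure (DivR M δ)
  monoid_eq : N = Submonoid.closure (DivR M δ)
  div_eq : DivR M δ = DivR M Δ ∩ (N : Set G)

/-- `a` is an unmovable element of `M`. -/
def IsUnmovable (M : Submonoid G) (Δ a : G) : Prop := a ∈ M ∧ ¬ LeR M Δ a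

/-- `α = a Δ ^ k` is the `Δ`-form of `α`. -/
def IsDeltaForm (M : Submonoid G) (Δ α a : G) (k : ℤ) : Prop :=
  IsUnmovable M Δ a ∧ α = a * Δ ^ k

/-- `b` is the (right) `N`-tail of `a`. -/
def IsTail (M N : Submonoid G) (a b : G) : Prop :=
  b ∈ N ∧ ∀ c ∈ N, LeR M c a ↔ LeR M c b

/-- `AlternatingTails M N₁ N₂ a [a₁, a₂, …, a_p]` says that `a = a_p ⋯ a₂ a₁`, where `a_i` is the
`N₁`-tail of `a_p ⋯ a_i` for `i` odd, and its `N₂`-tail for `i` even. -/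
def AlternatingTails (M : Submonoid G) : Submonoid G → Submonoid G → G → List G → Prop
  | _, _, a, [] => a = 1
  | N₁, N₂, a, x :: l => IsTail M N₁ a x ∧ AlternatingTails M N₂ N₁ (a * x⁻¹) l

/-- `a = a_p ⋯ a₂ a₁` is the (right) alternating form of `a ≠ 1` with respect to `(N₂, N₁)`, where
`l = [a₁, a₂, …, a_p]`; the leftmost factor `a_p` is required to be non-trivial. -/
def IsAlternatingForm (M N₂ N₁ : Submonoid G) (a : G) (l : List G) : Prop :=
  AlternatingTails M N₁ N₂ a l ∧ ∀ x ∈ l.getLast?, x ≠ 1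

open Classical in
/-- The `(N₂, N₁)`-breadth of `a`: the length of the alternating form of `a`, with the convention
that the breadth of `1` is `1`. (The alternating form is unique, so the infimum is over a
singleton.) -/
noncomputable def breadth (M N₂ N₁ : Submonoid G) (a : G) : ℕ :=
  if a = 1 then 1 else sInf {p | ∃ l : List G, IsAlternatingForm M N₂ N₁ a l ∧ l.length = p}

/-- A tuple of candidates for a Garside structure `(G, M, Δ)` together with a pair of
parabolic substructures `(H, N, Λ)` and `(G₁, M₁, Δ₁)`. This is bare data; the laws
are in `OrderingTuple.IsAdmissible`. -/
structure OrderingTuple (G : Type*) [Group G] where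
  M : Submonoid G
  Δ : G
  H : Subgroup G
  N : Submonoid G
  Λ : G
  G₁ : Subgroup G
  M₁ : Submonoid G
  Δ₁ : G

namespace OrderingTuple

/-- `(G, M, Δ)` is a Garside structure with two parabolic substructures `(H, N, Λ)` and
`(G₁, M₁, Δ₁)`, such that `N ≠ M`, `M₁ ≠ M`, `N ∪ M₁` generates `M`, `Δ` is central in `G`,
and `Δ₁` is central in `G₁`. -/
structure IsAdmissible (D : OrderingTuple G) : Prop where
  garside : IsGarsideStructure D.M D.Δ
  parabolic_H : IsParabolicSubstructure D.M D.Δ D.H D.N D.Λ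
  parabolic_G₁ : IsParabolicSubstructure D.M D.Δ D.G₁ D.M₁ D.Δ₁
  N_ne : D.N ≠ D.M
  M₁_ne : D.M₁ ≠ D.M
  closure_union : Submonoid.closure ((D.N : Set G) ∪ (D.M₁ : Set G)) = D.M
  central : ∀ g : G, D.Δ * g = g * D.Δ
  central₁ : ∀ g ∈ D.G₁, D.Δ₁ * g = g * D.Δ₁

/-- The depth of `a` with respect to `(N, M₁)`: `(bh a - 1) / 2` if `bh a` is odd and
`bh a / 2` if `bh a` is even. -/
noncomputable def depth (D : OrderingTuple G) (a : G) : ℕ :=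
  if Odd (breadth D.M D.N D.M₁ a) then (breadth D.M D.N D.M₁ a - 1) / 2
  else breadth D.M D.N D.M₁ a / 2

/-- `α` is `(H, G₁)`-negative. -/
def IsNegative (D : OrderingTuple G) (α : G) : Prop :=
  ∃ (a : G) (k : ℕ), IsDeltaForm D.M D.Δ α a (-(k : ℤ)) ∧ 1 ≤ k ∧ D.depth a < D.depth (D.Δ ^ k)

/-- The set `P` of `(H, G₁)`-positive elements. -/
def positives (D : OrderingTuple G) : Set G := {α | D.IsNegative α⁻¹}

/-- The set `P⁻¹` of `(H, G₁)`-negative elements. -/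
def negatives (D : OrderingTuple G) : Set G := {α | D.IsNegative α}

/-- `(H, G₁)` is a Dehornoy structure on `G`. -/
structure IsDehornoyStructure (D : OrderingTuple G) : Prop where
  admissible : D.IsAdmissible
  mul_mem : ∀ α ∈ D.positives, ∀ β ∈ D.positives, α * β ∈ D.positives
  mul_mul_mem : ∀ g ∈ D.G₁, ∀ α ∈ D.positives, ∀ h ∈ D.G₁, g * α * h ∈ D.positives
  union_eq : D.positives ∪ D.negatives ∪ (D.G₁ : Set G) = Set.univ
  disjoint_pos_neg : Disjoint D.positives D.negatives
  disjoint_pos_G₁ : Disjoint D.positives (D.G₁ : Set G)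
  disjoint_neg_G₁ : Disjoint D.negatives (D.G₁ : Set G)

/-- Condition A with constant `ζ`. -/
def ConditionA (D : OrderingTuple G) (ζ : ℕ) : Prop :=
  1 ≤ ζ ∧ ∀ k : ℕ, 1 ≤ k → D.depth (D.Δ ^ k) = ζ * k + 1

/-- The element `θ = Δ Δ₁⁻¹`. -/
def theta (D : OrderingTuple G) : G := D.Δ * D.Δ₁⁻¹

/-- The set `Θ` of theta elements. -/
def thetaSet (D : OrderingTuple G) : Set G :=
  {a | ∃ k : ℕ, 1 ≤ k ∧ ∃ a₀ ∈ D.M₁, a = D.theta ^ k * a₀}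

/-- The set `Θ ∪ M₁`. -/
def thetaBar (D : OrderingTuple G) : Set G := D.thetaSet ∪ (D.M₁ : Set G)

/-- Condition B with constant `ζ` for the pair `(a, b)`, where `c Δ ^ t` is the `Δ`-form of
`a b`. -/
def PairConditionB (D : OrderingTuple G) (ζ : ℕ) (a b : G) : Prop :=
  ∀ (c : G) (t : ℤ), IsDeltaForm D.M D.Δ (a * b) c t →
    ∃ ε : ℤ, (ε = 0 ∨ ε = 1) ∧
      (D.depth c : ℤ) = D.depth a + D.depth b - ζ * t - ε ∧
      ((a ∈ D.thetaSet ∨ b ∈ D.thetaSet ∨ c ∈ D.M₁) → ε = 1)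

/-- Condition B with constant `ζ`. -/
def ConditionB (D : OrderingTuple G) (ζ : ℕ) : Prop :=
  1 ≤ ζ ∧ ∀ a b : G, IsUnmovable D.M D.Δ a → IsUnmovable D.M D.Δ b →
    ¬ (a ∈ D.thetaBar ∧ b ∈ D.thetaBar) → D.PairConditionB ζ a b

end OrderingTuple

/-- `P` is the positive cone of a left-order on `G`: a strict total order `lt`, invariant under
left multiplication, such that `lt α β` if and only if `α⁻¹ β ∈ P`. -/
def IsPositiveCone (P : Set G) : Prop :=
  ∃ lt : G → G → Prop, IsStrictTotalOrder G lt ∧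
    (∀ γ α β, lt α β → lt (γ * α) (γ * β)) ∧
    ∀ α β, lt α β ↔ α⁻¹ * β ∈ P

/-- For a sign `ε = ±1`, the set `P ^ ε`, i.e. `P` or the set of inverses of elements of `P`. -/
def signedSet (P : Set G) (ε : ℤˣ) : Set G := {α | α ^ (ε : ℤ) ∈ P}

/-- The alternating product `x y x ⋯` with `m` factors. -/
def altProd (x y : G) : ℕ → G
  | 0 => 1
  | n + 1 => x * altProd y x n

end General

/-- The two generating letters. -/
inductive Letter
  | s
  | t

/-- The defining relation `Π(s, t, m) = Π(t, s, m)`. -/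
def dihedralRels (m : ℕ) : Set (FreeGroup Letter) :=
  {altProd (FreeGroup.of Letter.s) (FreeGroup.of Letter.t) m *
    (altProd (FreeGroup.of Letter.t) (FreeGroup.of Letter.s) m)⁻¹}

/-- The Artin group of type `I₂(m)`, `⟨s, t ∣ Π(s, t, m) = Π(t, s, m)⟩`. -/
abbrev DihedralArtin (m : ℕ) : Type := PresentedGroup (dihedralRels m)

/-- The standard generator `s`. -/
def genS (m : ℕ) : DihedralArtin m := PresentedGroup.of Letter.s

/-- The standard generator `t`. -/
def genT (m : ℕ) : DihedralArtin m := PresentedGroup.of Letter.t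

/-- In the Artin group of type `I₂(2k)`: `M` is the submonoid generated by `s, t`, `Δ = (st)^k`,
`H` and `N` are the subgroup and the submonoid generated by `Λ = s`, and `G₁` and `M₁` are the
subgroup and the submonoid generated by `Δ₁ = t`. -/
def evenTuple (k : ℕ) : OrderingTuple (DihedralArtin (2 * k)) where
  M := Submonoid.closure {genS (2 * k), genT (2 * k)}
  Δ := (genS (2 * k) * genT (2 * k)) ^ k
  H := Subgroup.closure {genS (2 * k)}
  N := Submonoid.closure {genS (2 * k)}
  Λ := genS (2 * k)
  G₁ := Subgroup.closure {genT (2 * k)}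
  M₁ := Submonoid.closure {genT (2 * k)}
  Δ₁ := genT (2 * k)

end DehornoyStructures

open DehornoyStructures

/-!
The group `G` acts on pairs `(w, n)`, where `w` is a reduced word in `s`, `t` (one without
alternating subword of length `2 * k`) and `n` is an integer: a generator is put in front of `w`,
and if this completes an alternating subword of length `2 * k`, that subword, which spells the
central element `Δ`, is removed and `n` is increased by one. The two alternating words of length
`2 * k` act alike (`wordPerm_alt`), so this is an action of `G`, and every element has a unique
normal form `w Δ ^ n` (`exists_normalForm`, `normalForm_unique`). The monoid consists of the
elements with `n ≥ 0`, its unmovable elements are spelled by the reduced words, and `Δ`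
right-divides every element that `s` and `t` both right-divide (`leR_delta_of_leR_gen`). The last
fact yields least common multiples by induction on length, and with them the lattice property.

The depth of an unmovable element is the number of `s`-blocks of its reduced word (`depth_eval`).
Everything else is about the signed depth of `w Δ ^ n`, which is the number of `s`-blocks of `w`
plus `(k - 1) * n`. It is a quasimorphism: the defect of a product is `0` or `1`, and it is `1` if
the two factors are inverse to each other up to a power of `Δ` and are not themselves powers of
`Δ` (`wordDefect_bounds`). For this, remove the copies of `Δ` that straddle the junction of the
two words one after the other. Each contains `k` blocks, and adds `k - 1` to the signed depth of
the product; the difference vanishes if its first or last block continues into what remains of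
the words, and is the defect if not, which happens for the last copy only. Moreover,
multiplication by `t` changes the signed depth of no element outside the subgroup generated by
`t` and `Δ`. These facts give Condition B. Condition A follows since the unmovable part of
`t ^ (-n)` is also what remains of `Δ ^ n` when its tail `t ^ n` is removed (`depth_delta_pow`).

An element is negative exactly when it lies outside `G₁` and its signed depth is at most `0`, and
positive exactly when it lies outside `G₁` and its signed depth is at least `1`
(`isNegative_iff`, `mem_positives_iff`). The axioms of a Dehornoy structure and the positive cones
follow from the bounds on the defect and the invariance under `t`.
-/

namespace DehornoyStructures

variable {k : ℕ}

/-! ### Reduced words -/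

/-- The alternating word `x y x ⋯` with `n` letters, where `y` is the letter other than `x`.
Words in the generators are lists of Booleans, `true` standing for `s` and `false` for `t`. -/
def alt : Bool → ℕ → List Bool
  | _, 0 => []
  | x, n + 1 => x :: alt (!x) n

@[simp] lemma alt_zero (x : Bool) : alt x 0 = [] := rfl

lemma alt_succ (x : Bool) (n : ℕ) : alt x (n + 1) = x :: alt (!x) n := rfl

@[simp] lemma length_alt (x : Bool) (n : ℕ) : (alt x n).length = n := by
  induction n generalizing x with
  | zero => rfl
  | succ n ih => simp [alt_succ, ih]

lemma alt_add (x : Bool) (a b : ℕ) : alt x (a + b) = alt x a ++ alt (x ^^ a.bodd) b := by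
  induction a generalizing x with
  | zero => simp
  | succ a ih =>
    rw [show a + 1 + b = (a + b) + 1 by omega, alt_succ, ih, alt_succ, Nat.bodd_succ]
    cases x <;> cases a.bodd <;> rfl

lemma head?_alt_succ (x : Bool) (n : ℕ) : (alt x (n + 1)).head? = some x := rfl

lemma getLast?_alt_succ (x : Bool) (n : ℕ) :
    (alt x (n + 1)).getLast? = some (x ^^ n.bodd) := by
  rw [alt_add]; simp [alt_succ]

lemma isChain_alt (x : Bool) (n : ℕ) : (alt x n).IsChain (· ≠ ·) := by
  induction n generalizing x with
  | zero => simp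
  | succ n ih =>
    cases n with
    | zero => simp [alt_succ]
    | succ n =>
      have := ih (!x)
      rw [alt_succ] at this
      rw [alt_succ, alt_succ, List.isChain_cons_cons]
      exact ⟨by simp, this⟩

/-- Consecutive letters of an alternating word differ. -/
lemma ne_of_append_eq_alt {a b : List Bool} {z y y' : Bool} {n : ℕ} (h : a ++ b = alt z n)
    (ha : a.getLast? = some y) (hb : b.head? = some y') : y ≠ y' := by
  have hc := isChain_alt z n
  rw [← h, List.isChain_append] at hc
  exact hc.2.2 y (by simp [ha]) y' (by simp [hb])

/-- A word is reduced when it contains no alternating subword with `2 * k` letters. Reduced words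
are the normal forms of the unmovable elements. -/
def Red (k : ℕ) (w : List Bool) : Prop := ∀ y, ¬ alt y (2 * k) <:+: w

lemma Red.of_infix {v w : List Bool} (h : Red k w) (hv : v <:+: w) : Red k v :=
  fun y hy => h y (hy.trans hv)

lemma Red.left {v w : List Bool} (h : Red k (v ++ w)) : Red k v :=
  h.of_infix (List.infix_append_left)

lemma Red.right {v w : List Bool} (h : Red k (v ++ w)) : Red k w :=
  h.of_infix (List.infix_append_right)

lemma red_of_length_lt {w : List Bool} (h : w.length < 2 * k) : Red k w := fun y hy => by
  have := hy.length_le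
  simp at this
  omega

/-- If `a` and `b` are reduced and `a b` is not, then some alternating subword with `2 * k` letters
straddles the junction; the leftmost one is preceded by a letter equal to its first letter. -/
lemma exists_straddle {a b : List Bool} (ha : Red k a) (hb : Red k b) (hab : ¬ Red k (a ++ b)) :
    ∃ p a₂ b₂ q z, a = p ++ a₂ ∧ b = b₂ ++ q ∧ a₂ ++ b₂ = alt z (2 * k) ∧ a₂ ≠ [] ∧ b₂ ≠ [] ∧
      (∀ y, p.getLast? = some y → y = z) := by
  have key : ∀ n : ℕ, ∀ p a₂ b₂ q z, p.length = n → a = p ++ a₂ → b = b₂ ++ q →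
      a₂ ++ b₂ = alt z (2 * k) → a₂ ≠ [] → b₂ ≠ [] →
      ∃ p a₂ b₂ q z, a = p ++ a₂ ∧ b = b₂ ++ q ∧ a₂ ++ b₂ = alt z (2 * k) ∧ a₂ ≠ [] ∧ b₂ ≠ [] ∧
      (∀ y, p.getLast? = some y → y = z) := by
    intro n
    induction n with
    | zero =>
      intro p a₂ b₂ q z hp h1 h2 h3 h4 h5
      refine ⟨p, a₂, b₂, q, z, h1, h2, h3, h4, h5, ?_⟩
      simp [List.length_eq_zero_iff.1 hp]
    | succ n ih =>
      intro p a₂ b₂ q z hp h1 h2 h3 h4 h5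
      by_cases hz : ∀ y, p.getLast? = some y → y = z
      · exact ⟨p, a₂, b₂, q, z, h1, h2, h3, h4, h5, hz⟩
      push Not at hz
      obtain ⟨y, hy, hyz⟩ := hz
      obtain ⟨p', rfl⟩ := List.getLast?_eq_some_iff.1 hy
      obtain rfl : y = !z := by cases y <;> cases z <;> simp_all
      -- Shift the alternating subword by one letter to the left.
      obtain ⟨b', l, rfl⟩ : ∃ b' l, b₂ = b' ++ [l] := by
        rcases List.eq_nil_or_concat b₂ with h | ⟨b', l, h⟩
        · exact absurd h h5
        · exact ⟨b', l, by simpa using h⟩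
      obtain ⟨j, hj⟩ : ∃ j, 2 * k = j + 1 := by
        have := congrArg List.length h3
        simp at this
        exact ⟨a₂.length + b'.length, by omega⟩
      have h3' : ((!z) :: a₂) ++ b' = alt (!z) (2 * k) := by
        rw [hj, alt_add z j 1, ← List.append_assoc] at h3
        have := (List.append_inj' h3 (by simp [alt_succ])).1
        rw [hj, alt_succ, Bool.not_not, List.cons_append, this]
      have h1' : a = p' ++ ((!z) :: a₂) := by simp [h1]
      refine ih p' ((!z) :: a₂) b' (l :: q) (!z) (by simpa using hp) h1' (by simp [h2]) h3'
        (by simp) ?_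
      rintro rfl
      refine ha (!z) ?_
      rw [← h3', h1']
      exact ⟨p', [], by simp⟩
  simp only [Red, not_forall, not_not] at hab
  obtain ⟨z, hz⟩ := hab
  rw [List.infix_append_iff_ne_nil] at hz
  rcases hz with hz | hz | ⟨t, s, ht, hs, hts, ⟨p, hp⟩, ⟨q, hq⟩⟩
  · exact absurd hz (ha z)
  · exact absurd hz (hb z)
  · exact key _ p t s q z rfl hp.symm hq.symm hts.symm ht hs

/-- A concatenation of reduced words is reduced if the letters at the junction agree. -/
lemma Red.append {a b : List Bool} (ha : Red k a) (hb : Red k b)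
    (h : ∀ y z, a.getLast? = some y → b.head? = some z → y = z) : Red k (a ++ b) := by
  by_contra hab
  obtain ⟨p, a₂, b₂, q, z, rfl, rfl, h3, h4, h5, -⟩ := exists_straddle ha hb hab
  obtain ⟨y, hy⟩ : ∃ y, a₂.getLast? = some y := ⟨_, List.getLast?_eq_some_getLast h4⟩
  obtain ⟨y', hy'⟩ : ∃ y', b₂.head? = some y' := ⟨_, List.head?_eq_some_head h5⟩
  refine ne_of_append_eq_alt h3 hy hy' (h y y' ?_ ?_)
  · rw [List.getLast?_append_of_ne_nil _ h4, hy]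
  · rw [List.head?_append_of_ne_nil _ h5, hy']

/-- Every word is an alternating word followed by a word that does not prolong it. -/
lemma exists_alt_append (x : Bool) (w : List Bool) :
    ∃ r w', w = alt x r ++ w' ∧ ∀ y, w'.head? = some y → y = !(x ^^ r.bodd) := by
  induction w generalizing x with
  | nil => exact ⟨0, [], by simp⟩
  | cons y w ih =>
    by_cases hy : y = x
    · subst hy
      obtain ⟨r, w', h, h'⟩ := ih (!y)
      refine ⟨r + 1, w', by simp [alt_succ, ← h], fun z hz => ?_⟩
      rw [h' z hz, Nat.bodd_succ]
      cases y <;> cases r.bodd <;> rfl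
    · refine ⟨0, y :: w, by simp, fun z hz => ?_⟩
      simp at hz
      subst hz
      cases y <;> cases x <;> simp_all

/-! ### Counting blocks -/

/-- The number of maximal blocks of consecutive letters `s` in a word. -/
def sBlocks : List Bool → ℕ
  | [] => 0
  | x :: w => sBlocks w + if x = true ∧ w.head? ≠ some true then 1 else 0

lemma sBlocks_append (a b : List Bool) :
    sBlocks (a ++ b) + (if a.getLast? = some true ∧ b.head? = some true then 1 else 0) =
      sBlocks a + sBlocks b := by
  induction a with
  | nil => simp [sBlocks]
  | cons x a ih =>
    cases a with
    | nil =>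
      simp only [List.nil_append, List.cons_append, sBlocks]
      cases x <;> by_cases h : b.head? = some true <;> simp [h, Nat.add_comm]
    | cons y a =>
      have h1 : (x :: y :: a).getLast? = (y :: a).getLast? := by simp
      have h2 : ((y :: a) ++ b).head? = (y :: a).head? := by simp
      rw [h1, List.cons_append, sBlocks, sBlocks, h2]
      omega

lemma sBlocks_alt (x : Bool) : sBlocks (alt x (2 * k)) = k := by
  induction k with
  | zero => rfl
  | succ k ih =>
    rw [show 2 * (k + 1) = 2 * k + 1 + 1 by ring, alt_succ, alt_succ, Bool.not_not]
    simp only [sBlocks, ih]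
    cases x <;> cases k <;> simp [Nat.mul_succ, alt_succ]

lemma eq_replicate_of_sBlocks_eq_zero {w : List Bool} (h : sBlocks w = 0) :
    w = List.replicate w.length false := by
  induction w with
  | nil => rfl
  | cons x w ih =>
    simp only [sBlocks, Nat.add_eq_zero_iff] at h
    have hw := ih h.1
    have hx : x = false := by
      by_contra hx
      have h2 : w.head? = some true := by
        by_contra hc
        simp [hc, eq_true_of_ne_false hx] at h
      rw [hw] at h2
      cases hl : w.length <;> simp [hl, List.replicate_succ] at h2
    rw [hx, List.length_cons, List.replicate_succ, ← hw]

lemma sBlocks_replicate (n : ℕ) : sBlocks (List.replicate n false) = 0 := by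
  induction n with
  | zero => rfl
  | succ n ih => simp [List.replicate_succ, sBlocks, ih]

/-! ### The action of the group on normal forms -/

lemma Red.pos {w : List Bool} (h : Red k w) : 0 < k := by
  rcases Nat.eq_zero_or_pos k with rfl | h'
  · exact absurd (List.nil_infix) (h true)
  · exact h'

/-- The alternating word with `2 * k - 1` letters whose product with the letter `x`, on either
side, is `Δ`. -/
def comp (k : ℕ) (x : Bool) : List Bool := alt (!x) (2 * k - 1)

lemma cons_comp (hk : 0 < k) (x : Bool) : x :: comp k x = alt x (2 * k) := by
  obtain ⟨j, hj⟩ : ∃ j, 2 * k = j + 1 := ⟨2 * k - 1, by omega⟩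
  rw [comp, hj, alt_succ, Nat.add_sub_cancel]

lemma bodd_two_mul_sub_one (hk : 0 < k) : (2 * k - 1).bodd = true := by
  obtain ⟨j, rfl⟩ : ∃ j, k = j + 1 := ⟨k - 1, by omega⟩
  rw [show 2 * (j + 1) - 1 = 2 * j + 1 by omega]
  simp

lemma comp_append_singleton (hk : 0 < k) (x : Bool) : comp k x ++ [x] = alt (!x) (2 * k) := by
  obtain ⟨j, hj⟩ : ∃ j, 2 * k = j + 1 := ⟨2 * k - 1, by omega⟩
  have := bodd_two_mul_sub_one hk
  rw [comp, hj, alt_add]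
  rw [hj] at this
  simp at this
  simp [this, alt_succ]

lemma head?_comp (hk : 0 < k) (x : Bool) : (comp k x).head? = some (!x) := by
  obtain ⟨j, hj⟩ : ∃ j, 2 * k - 1 = j + 1 := ⟨2 * k - 2, by omega⟩
  rw [comp, hj, head?_alt_succ]

lemma getLast?_comp (hk : 0 < k) (x : Bool) : (comp k x).getLast? = some (!x) := by
  have hb := bodd_two_mul_sub_one hk
  obtain ⟨j, hj⟩ : ∃ j, 2 * k - 1 = j + 1 := ⟨2 * k - 2, by omega⟩
  rw [hj, Nat.bodd_succ] at hb
  rw [comp, hj, getLast?_alt_succ]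
  simp_all

lemma comp_ne_nil (hk : 0 < k) (x : Bool) : comp k x ≠ [] := by
  intro h
  have := head?_comp hk x
  simp [h] at this

lemma length_comp (x : Bool) : (comp k x).length = 2 * k - 1 := length_alt _ _

lemma red_comp (hk : 0 < k) (x : Bool) : Red k (comp k x) :=
  red_of_length_lt (by rw [length_comp]; omega)

lemma Red.not_comp_prefix {w : List Bool} {x : Bool} (h : Red k (x :: w)) :
    ¬ comp k x <+: w := by
  rintro ⟨v, rfl⟩
  refine h x ?_
  rw [← cons_comp h.pos]
  exact ⟨[], v, by simp⟩

lemma Red.cons_of_not_prefix {w : List Bool} {x : Bool} (h : Red k w) (hx : ¬ comp k x <+: w) :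
    Red k (x :: w) := by
  intro y hy
  rcases List.infix_cons_iff.1 hy with hp | hi
  · rw [← cons_comp h.pos, List.cons_prefix_cons] at hp
    obtain ⟨rfl, hp⟩ := hp
    exact hx hp
  · exact h y hi

lemma Red.comp_append {w : List Bool} {x : Bool} (h : Red k w) (hx : w.head? ≠ some x) :
    Red k (comp k x ++ w) := by
  refine (red_comp h.pos x).append h fun y z hy hz => ?_
  rw [getLast?_comp h.pos] at hy
  rw [hz] at hx
  cases x <;> cases y <;> cases z <;> simp_all

/-- Normal forms: a pair of a reduced word `w` and an integer `n` stands for `w Δ ^ n`. -/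
abbrev NForm (k : ℕ) : Type := {w : List Bool // Red k w} × ℤ

open Classical in
/-- Left multiplication of a normal form by the generator `x`. -/
noncomputable def push (x : Bool) (p : NForm k) : NForm k :=
  if h : comp k x <+: p.1.1 then
    (⟨p.1.1.drop (2 * k - 1), p.1.2.of_infix (List.drop_suffix _ _).isInfix⟩, p.2 + 1)
  else (⟨x :: p.1.1, p.1.2.cons_of_not_prefix h⟩, p.2)

/-- Left multiplication of a normal form by the inverse of the generator `x`. -/
def pop (x : Bool) (p : NForm k) : NForm k :=
  if h : p.1.1.head? = some x then
    (⟨p.1.1.tail, p.1.2.of_infix (List.tail_suffix _).isInfix⟩, p.2)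
  else (⟨comp k x ++ p.1.1, p.1.2.comp_append h⟩, p.2 - 1)

lemma push_eq_cons {x : Bool} {w : List Bool} {n : ℤ} (h : Red k (x :: w)) :
    push x (⟨w, h.of_infix (List.suffix_cons _ _).isInfix⟩, n) = ((⟨x :: w, h⟩, n) : NForm k) := by
  rw [push, dif_neg h.not_comp_prefix]

lemma push_comp_append {x : Bool} {w : List Bool} {n : ℤ} (h : Red k (comp k x ++ w)) :
    push x (⟨comp k x ++ w, h⟩, n) = ((⟨w, h.right⟩, n + 1) : NForm k) := by
  rw [push, dif_pos (List.prefix_append _ _)]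
  congr 2
  simp only [List.drop_left' (length_comp x)]

lemma pop_cons {x : Bool} {w : List Bool} {n : ℤ} (h : Red k (x :: w)) :
    pop x (⟨x :: w, h⟩, n) =
      ((⟨w, h.of_infix (List.suffix_cons _ _).isInfix⟩, n) : NForm k) := by
  simp [pop]

lemma pop_of_head?_ne {x : Bool} {w : List Bool} {n : ℤ} (h : Red k w) (hx : w.head? ≠ some x) :
    pop x (⟨w, h⟩, n) = ((⟨comp k x ++ w, h.comp_append hx⟩, n - 1) : NForm k) := by
  rw [pop, dif_neg hx]

lemma pop_push (x : Bool) (p : NForm k) : pop x (push x p) = p := by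
  obtain ⟨⟨w, h⟩, n⟩ := p
  by_cases hx : comp k x <+: w
  · obtain ⟨v, rfl⟩ := hx
    rw [push_comp_append, pop_of_head?_ne, add_sub_cancel_right]
    intro hv
    obtain ⟨v', rfl⟩ : ∃ v', v = x :: v' := List.head?_eq_some_iff.1 hv
    refine h (!x) ?_
    rw [← comp_append_singleton h.pos]
    exact ⟨[], v', by simp⟩
  · rw [push_eq_cons (h.cons_of_not_prefix hx), pop_cons]

lemma push_pop (x : Bool) (p : NForm k) : push x (pop x p) = p := by
  obtain ⟨⟨w, h⟩, n⟩ := p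
  by_cases hx : w.head? = some x
  · obtain ⟨v, rfl⟩ : ∃ v, w = x :: v := List.head?_eq_some_iff.1 hx
    rw [pop_cons, push_eq_cons h]
  · rw [pop_of_head?_ne h hx, push_comp_append, sub_add_cancel]

/-- Left multiplication by a generator, as a permutation of the normal forms. -/
noncomputable def pushPerm (k : ℕ) (x : Bool) : Equiv.Perm (NForm k) where
  toFun := push x
  invFun := pop x
  left_inv := pop_push x
  right_inv := push_pop x

/-- Left multiplication of normal forms by a word. -/
noncomputable def wordPerm (k : ℕ) (l : List Bool) : Equiv.Perm (NForm k) :=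
  (l.map (pushPerm k)).prod

@[simp] lemma wordPerm_nil : wordPerm k [] = 1 := rfl

lemma wordPerm_cons (x : Bool) (l : List Bool) :
    wordPerm k (x :: l) = pushPerm k x * wordPerm k l := by simp [wordPerm]

lemma wordPerm_append (a b : List Bool) :
    wordPerm k (a ++ b) = wordPerm k a * wordPerm k b := by simp [wordPerm]

lemma wordPerm_apply_of_red {l w : List Bool} {n : ℤ} (h : Red k (l ++ w)) :
    wordPerm k l (⟨w, h.right⟩, n) = (⟨l ++ w, h⟩, n) := by
  induction l with
  | nil => rfl
  | cons x l ih =>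
    rw [wordPerm_cons, Equiv.Perm.mul_apply, ih (h.of_infix (List.suffix_cons _ _).isInfix)]
    exact push_eq_cons h

/-- Both alternating words with `2 * k` letters act on the normal forms by `n ↦ n + 1`. If `w`
begins with a maximal alternating word `alt x r`, the last `2 * k - r` letters complete it to a
copy of `Δ`, and the first `r` letters restore it. -/
lemma wordPerm_alt (x : Bool) (p : NForm k) :
    wordPerm k (alt x (2 * k)) p = (p.1, p.2 + 1) := by
  obtain ⟨⟨w, h⟩, n⟩ := p
  obtain ⟨r, w', rfl, hw'⟩ := exists_alt_append x w
  have hr : r < 2 * k := by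
    by_contra hr
    obtain ⟨d, rfl⟩ := Nat.exists_eq_add_of_le (not_lt.1 hr)
    refine h x ?_
    rw [alt_add]
    exact ⟨[], alt (x ^^ (2 * k).bodd) d ++ w', by simp⟩
  obtain ⟨d, hd⟩ : ∃ d, 2 * k = r + (d + 1) := ⟨2 * k - r - 1, by omega⟩
  set z := x ^^ r.bodd with hz
  have hpar : ((!z) ^^ d.bodd) = x := by
    have := congrArg Nat.bodd hd
    simp only [Nat.bodd_mul, Nat.bodd_two, Bool.false_and, Nat.bodd_add, Nat.bodd_one] at this
    rw [hz]
    revert this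
    cases x <;> cases r.bodd <;> cases d.bodd <;> simp
  have hcomp : alt (!z) d ++ alt x r = comp k z := by
    rw [comp, show 2 * k - 1 = d + r by omega, alt_add, hpar]
  have hred : Red k (comp k z ++ w') := h.right.comp_append fun hc =>
    absurd (hw' _ hc) (by simp)
  have hred' : Red k (alt (!z) d ++ (alt x r ++ w')) := by
    rwa [← List.append_assoc, hcomp]
  rw [hd, alt_add, wordPerm_append, Equiv.Perm.mul_apply, ← hz, alt_succ, wordPerm_cons,
    Equiv.Perm.mul_apply, wordPerm_apply_of_red hred']
  simp only [← List.append_assoc, hcomp]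
  change wordPerm k (alt x r) (push z _) = _
  rw [push_comp_append, wordPerm_apply_of_red h]

lemma altProd_eq_prod_map {G : Type*} [Group G] (g : Bool → G) (x : Bool) (n : ℕ) :
    altProd (g x) (g !x) n = ((alt x n).map g).prod := by
  induction n generalizing x with
  | zero => rfl
  | succ n ih =>
    have := ih (!x)
    rw [Bool.not_not] at this
    simp [altProd, alt_succ, this]

/-- The Boolean that encodes a letter. -/
def Letter.toBool : Letter → Bool
  | .s => true
  | .t => false

lemma map_altProd {G G' : Type*} [Group G] [Group G'] (f : G →* G') (x y : G) (n : ℕ) :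
    f (altProd x y n) = altProd (f x) (f y) n := by
  induction n generalizing x y with
  | zero => simp [altProd]
  | succ n ih => simp [altProd, ih]

/-- The group acts on the normal forms by left multiplication. -/
noncomputable def actionHom (k : ℕ) : DihedralArtin (2 * k) →* Equiv.Perm (NForm k) :=
  PresentedGroup.toGroup (f := fun x : Letter => pushPerm k x.toBool) (by
    rintro _ rfl
    rw [map_mul, map_inv, map_altProd, map_altProd, FreeGroup.lift_apply_of,
      FreeGroup.lift_apply_of]
    have h1 := altProd_eq_prod_map (pushPerm k) true (2 * k)
    have h2 := altProd_eq_prod_map (pushPerm k) false (2 * k)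
    simp only [Bool.not_true, Bool.not_false] at h1 h2
    rw [Letter.toBool, Letter.toBool, h1, h2, mul_inv_eq_one]
    refine Equiv.ext fun p => ?_
    exact (wordPerm_alt true p).trans (wordPerm_alt false p).symm)

/-! ### Normal forms of group elements -/

/-- The generator named by a Boolean. -/
def gen (k : ℕ) : Bool → DihedralArtin (2 * k)
  | true => genS (2 * k)
  | false => genT (2 * k)

/-- The group element spelled by a word. -/
def eval (k : ℕ) (l : List Bool) : DihedralArtin (2 * k) := (l.map (gen k)).prod

/-- The element `Δ = (s t) ^ k`. -/
def delta (k : ℕ) : DihedralArtin (2 * k) := (genS (2 * k) * genT (2 * k)) ^ k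

@[simp] lemma eval_nil : eval k [] = 1 := rfl

lemma eval_cons (x : Bool) (l : List Bool) : eval k (x :: l) = gen k x * eval k l := by
  simp [eval]

lemma eval_append (a b : List Bool) : eval k (a ++ b) = eval k a * eval k b := by simp [eval]

lemma eval_singleton (x : Bool) : eval k [x] = gen k x := by simp [eval]

lemma eval_replicate (n : ℕ) (x : Bool) : eval k (List.replicate n x) = gen k x ^ n := by
  simp [eval]

lemma actionHom_gen (x : Bool) : actionHom k (gen k x) = pushPerm k x := by
  cases x <;> exact PresentedGroup.toGroup.of _

lemma actionHom_eval (l : List Bool) : actionHom k (eval k l) = wordPerm k l := by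
  induction l with
  | nil => simp
  | cons x l ih => rw [eval_cons, map_mul, ih, actionHom_gen, wordPerm_cons]

lemma eval_alt_true (k j : ℕ) :
    eval k (alt true (2 * j)) = (genS (2 * k) * genT (2 * k)) ^ j := by
  induction j with
  | zero => rfl
  | succ j ih =>
    rw [show 2 * (j + 1) = 2 * j + 1 + 1 by ring, alt_succ, alt_succ, eval_cons, eval_cons,
      Bool.not_not, ih, pow_succ', mul_assoc]
    rfl

lemma eval_alt (x : Bool) : eval k (alt x (2 * k)) = delta k := by
  have h : eval k (alt true (2 * k)) = eval k (alt false (2 * k)) := by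
    have h1 := altProd_eq_prod_map (gen k) true (2 * k)
    have h2 := altProd_eq_prod_map (gen k) false (2 * k)
    have hr := PresentedGroup.one_of_mem (rels := dihedralRels (2 * k)) (Set.mem_singleton _)
    rw [map_mul, map_inv, map_altProd, map_altProd, mul_inv_eq_one] at hr
    exact h1.symm.trans (hr.trans h2)
  cases x
  · rw [← h, eval_alt_true, delta]
  · rw [eval_alt_true, delta]

lemma gen_mul_eval_comp (hk : 0 < k) (x : Bool) : gen k x * eval k (comp k x) = delta k := by
  rw [← eval_cons, cons_comp hk, eval_alt]

lemma eval_comp_mul_gen (hk : 0 < k) (x : Bool) : eval k (comp k x) * gen k x = delta k := by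
  rw [← eval_singleton, ← eval_append, comp_append_singleton hk, eval_alt]

lemma closure_gen : Subgroup.closure (Set.range (gen k)) = ⊤ := by
  rw [← PresentedGroup.closure_range_of (dihedralRels (2 * k))]
  congr 1
  ext g
  constructor
  · rintro ⟨x, rfl⟩
    cases x
    · exact ⟨Letter.t, rfl⟩
    · exact ⟨Letter.s, rfl⟩
  · rintro ⟨x, rfl⟩
    cases x
    · exact ⟨true, rfl⟩
    · exact ⟨false, rfl⟩

lemma commute_delta_gen (x : Bool) : Commute (delta k) (gen k x) := by
  rcases Nat.eq_zero_or_pos k with rfl | hk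
  · simp [delta]
  change delta k * gen k x = gen k x * delta k
  nth_rw 1 [← gen_mul_eval_comp hk x]
  rw [mul_assoc, eval_comp_mul_gen hk]

lemma delta_comm (g : DihedralArtin (2 * k)) : Commute (delta k) g := by
  have h : g ∈ Subgroup.closure (Set.range (gen k)) := by rw [closure_gen]; trivial
  induction h using Subgroup.closure_induction with
  | mem g hg => obtain ⟨x, rfl⟩ := hg; exact commute_delta_gen x
  | one => exact Commute.one_right _
  | mul a b _ _ ha hb => exact ha.mul_right hb
  | inv a _ ha => exact ha.inv_right

lemma delta_zpow_comm (n : ℤ) (g : DihedralArtin (2 * k)) : Commute (delta k ^ n) g :=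
  (delta_comm g).zpow_left n

/-- The group element of a normal form. -/
def value (p : NForm k) : DihedralArtin (2 * k) := eval k p.1.1 * delta k ^ p.2

lemma value_push (x : Bool) (p : NForm k) : value (push x p) = gen k x * value p := by
  obtain ⟨⟨w, h⟩, n⟩ := p
  by_cases hx : comp k x <+: w
  · obtain ⟨v, rfl⟩ := hx
    rw [push_comp_append]
    simp only [value]
    rw [eval_append, ← mul_assoc, ← mul_assoc, gen_mul_eval_comp h.pos, zpow_add_one,
      (delta_comm (eval k v)).eq, mul_assoc, ((delta_comm (delta k)).zpow_right n).eq]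
  · rw [push_eq_cons (h.cons_of_not_prefix hx)]
    simp only [value, eval_cons, mul_assoc]

lemma value_actionHom (g : DihedralArtin (2 * k)) (p : NForm k) :
    value (actionHom k g p) = g * value p := by
  have h : g ∈ Subgroup.closure (Set.range (gen k)) := by rw [closure_gen]; trivial
  induction h using Subgroup.closure_induction generalizing p with
  | mem g hg =>
    obtain ⟨x, rfl⟩ := hg
    rw [actionHom_gen]
    exact value_push x p
  | one => simp
  | mul a b _ _ ha hb => rw [map_mul, Equiv.Perm.mul_apply, ha, hb, mul_assoc]
  | inv a _ ha =>
    rw [eq_inv_mul_iff_mul_eq, ← ha, ← Equiv.Perm.mul_apply, ← map_mul]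
    simp

lemma actionHom_delta_zpow (n : ℤ) (p : NForm k) :
    actionHom k (delta k ^ n) p = (p.1, p.2 + n) := by
  have h1 : ∀ p : NForm k, actionHom k (delta k) p = (p.1, p.2 + 1) := fun p => by
    rw [← eval_alt true, actionHom_eval, wordPerm_alt]
  have h2 : ∀ p : NForm k, actionHom k (delta k)⁻¹ p = (p.1, p.2 - 1) := fun p => by
    rw [map_inv, Equiv.Perm.inv_eq_iff_eq, h1]
    simp
  induction n generalizing p with
  | zero => simp
  | succ n ih =>
    rw [zpow_add_one, map_mul, Equiv.Perm.mul_apply, h1, ih, add_assoc, add_comm (1 : ℤ)]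
  | pred n ih =>
    rw [zpow_sub_one, map_mul, Equiv.Perm.mul_apply, h2, ih, sub_add_eq_add_sub, add_sub_assoc]

/-- The empty word, as a normal form. -/
def emptyForm (hk : 0 < k) : NForm k := (⟨[], red_of_length_lt (by simp; omega)⟩, 0)

lemma actionHom_value (hk : 0 < k) (p : NForm k) :
    actionHom k (value p) (emptyForm hk) = p := by
  obtain ⟨⟨w, h⟩, n⟩ := p
  have h' : Red k (w ++ []) := by simpa using h
  rw [value, map_mul, Equiv.Perm.mul_apply, actionHom_delta_zpow, actionHom_eval]
  refine (wordPerm_apply_of_red (n := 0 + n) h').trans ?_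
  simp

/-- The bijection between normal forms and group elements. -/
noncomputable def valueEquiv (hk : 0 < k) : NForm k ≃ DihedralArtin (2 * k) where
  toFun := value
  invFun g := actionHom k g (emptyForm hk)
  left_inv := actionHom_value hk
  right_inv g := by rw [value_actionHom]; simp [emptyForm, value]

/-- Every element is the value of a normal form. -/
lemma exists_normalForm (hk : 0 < k) (g : DihedralArtin (2 * k)) :
    ∃ w n, Red k w ∧ g = eval k w * delta k ^ (n : ℤ) :=
  ⟨_, _, ((valueEquiv hk).symm g).1.2, ((valueEquiv hk).apply_symm_apply g).symm⟩

/-- The normal form of an element is unique. -/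
lemma normalForm_unique {w w' : List Bool} {n n' : ℤ} (hw : Red k w) (hw' : Red k w')
    (h : eval k w * delta k ^ n = eval k w' * delta k ^ n') : w = w' ∧ n = n' := by
  have := (valueEquiv hw.pos).injective (a₁ := (⟨w, hw⟩, n)) (a₂ := (⟨w', hw'⟩, n')) h
  simpa using this

/-! ### The signed depth and its defect -/

/-- The signed depth of an element with `Δ`-form `w Δ ^ n`: the number of `s`-blocks of the
reduced word `w`, plus `(k - 1) * n`. -/
noncomputable def signedDepth (hk : 0 < k) (g : DihedralArtin (2 * k)) : ℤ :=
  sBlocks ((valueEquiv hk).symm g).1.1 + (k - 1) * ((valueEquiv hk).symm g).2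

lemma signedDepth_eval_mul (hk : 0 < k) {w : List Bool} (hw : Red k w) (n : ℤ) :
    signedDepth hk (eval k w * delta k ^ n) = sBlocks w + (k - 1) * n := by
  have : (valueEquiv hk).symm (eval k w * delta k ^ n) = (⟨w, hw⟩, n) :=
    (valueEquiv hk).symm_apply_eq.2 rfl
  rw [signedDepth, this]

lemma signedDepth_eval (hk : 0 < k) {w : List Bool} (hw : Red k w) :
    signedDepth hk (eval k w) = sBlocks w := by
  simpa using signedDepth_eval_mul hk hw 0

lemma signedDepth_mul_delta_zpow (hk : 0 < k) (g : DihedralArtin (2 * k)) (n : ℤ) :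
    signedDepth hk (g * delta k ^ n) = signedDepth hk g + (k - 1) * n := by
  obtain ⟨w, j, hw, rfl⟩ := exists_normalForm hk g
  rw [mul_assoc, ← zpow_add, signedDepth_eval_mul hk hw, signedDepth_eval_mul hk hw]
  ring

lemma red_nil (hk : 0 < k) : Red k [] := red_of_length_lt (by simp; omega)

lemma signedDepth_delta_zpow (hk : 0 < k) (n : ℤ) :
    signedDepth hk (delta k ^ n) = (k - 1) * n := by
  simpa [sBlocks] using signedDepth_eval_mul hk (red_nil hk) n

/-- The amount by which the signed depth fails to be additive at the product of two words. -/
noncomputable def wordDefect (hk : 0 < k) (a b : List Bool) : ℤ :=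
  sBlocks a + sBlocks b - signedDepth hk (eval k a * eval k b)

lemma wordDefect_of_red_append (hk : 0 < k) {a b : List Bool} (h : Red k (a ++ b)) :
    wordDefect hk a b = if a.getLast? = some true ∧ b.head? = some true then 1 else 0 := by
  have := sBlocks_append a b
  rw [wordDefect, ← eval_append, signedDepth_eval hk h]
  split_ifs at this ⊢ <;> omega

/-- The defect is `0` or `1`, and it is `1` if the product is a power of `Δ` other than an empty
product. If `a b` is not reduced, remove a copy of `Δ` straddling the junction and compare with
the two remaining words. -/
lemma wordDefect_bounds (hk : 0 < k) : ∀ (N : ℕ) {a b : List Bool}, a.length = N → Red k a →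
    Red k b → (0 ≤ wordDefect hk a b ∧ wordDefect hk a b ≤ 1) ∧
      ∀ n : ℤ, eval k a * eval k b = delta k ^ n → a ≠ [] → wordDefect hk a b = 1 := by
  intro N
  induction N using Nat.strong_induction_on with
  | _ N ih =>
  intro a b hN ha hb
  by_cases hab : Red k (a ++ b)
  · refine ⟨?_, fun n hn ha' => ?_⟩
    · rw [wordDefect_of_red_append hk hab]
      split_ifs <;> simp
    · rw [← eval_append] at hn
      have := (normalForm_unique (n := 0) (n' := n) hab (red_nil hk) (by simpa using hn)).1
      exact absurd (List.append_eq_nil_iff.1 this).1 ha'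
  obtain ⟨p, a₂, b₂, q, z, rfl, rfl, h3, h4, h5, h6⟩ := exists_straddle ha hb hab
  have hp : Red k p := ha.left
  have hq : Red k q := hb.right
  have hlt : p.length < N := by
    have := List.length_pos_iff.2 h4
    rw [← hN, List.length_append]
    omega
  have hprod : eval k (p ++ a₂) * eval k (b₂ ++ q) = eval k p * eval k q * delta k ^ (1 : ℤ) := by
    rw [eval_append, eval_append, mul_assoc, ← mul_assoc (eval k a₂), ← eval_append, h3, eval_alt,
      (delta_comm _).eq, zpow_one, mul_assoc]
  have hlast : b₂.getLast? = some (!z) := by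
    have := congrArg List.getLast? h3
    rw [List.getLast?_append_of_ne_nil _ h5] at this
    obtain ⟨j, hj⟩ : ∃ j, 2 * k = j + 1 := ⟨2 * k - 1, by omega⟩
    rw [this, hj, getLast?_alt_succ, ← Nat.add_sub_cancel (n := j) (m := 1), ← hj,
      bodd_two_mul_sub_one hk]
    cases z <;> rfl
  have hhead : a₂.head? = some z := by
    have := congrArg List.head? h3
    rw [List.head?_append_of_ne_nil _ h4] at this
    obtain ⟨j, hj⟩ : ∃ j, 2 * k = j + 1 := ⟨2 * k - 1, by omega⟩
    rw [this, hj, head?_alt_succ]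
  have hsum : sBlocks a₂ + sBlocks b₂ = k := by
    rw [← sBlocks_append, h3, sBlocks_alt, if_neg, Nat.add_zero]
    rintro ⟨h, h'⟩
    exact ne_of_append_eq_alt h3 h h' rfl
  have hD : wordDefect hk (p ++ a₂) (b₂ ++ q) = wordDefect hk p q + 1
      - (if p.getLast? = some true ∧ z = true then 1 else 0)
      - (if z = false ∧ q.head? = some true then 1 else 0) := by
    have e1 := sBlocks_append p a₂
    have e2 := sBlocks_append b₂ q
    simp only [hhead] at e1
    simp only [hlast] at e2
    rw [wordDefect, wordDefect, hprod, signedDepth_mul_delta_zpow]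
    simp only [Option.some.injEq, Bool.not_eq_true'] at e1 e2
    zify at e1 e2 hsum
    linarith
  obtain ⟨⟨hD0, hD1⟩, hD2⟩ := ih _ hlt rfl hp hq
  have hpow : ∀ n : ℤ, eval k (p ++ a₂) * eval k (b₂ ++ q) = delta k ^ n →
      eval k p * eval k q = delta k ^ (n - 1) := fun n hn => by
    rw [zpow_sub, eq_mul_inv_iff_mul_eq, ← hprod, hn]
  have hnilp : p = [] → wordDefect hk p q = 0 := by
    rintro rfl
    rw [wordDefect_of_red_append hk (by simpa using hq)]
    simp
  have hnilq : q = [] → wordDefect hk p q = 0 := by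
    rintro rfl
    rw [wordDefect_of_red_append hk (by simpa using hp)]
    simp
  rcases List.eq_nil_or_concat p with hpe | ⟨p', y, hpe⟩
  · -- The leftmost word is exhausted.
    have h0 := hnilp hpe
    subst hpe
    refine ⟨?_, fun n hn _ => ?_⟩
    · rw [hD, h0]
      simp only [List.getLast?_nil, reduceCtorEq, false_and, if_false]
      split_ifs <;> simp
    · have := hpow n hn
      have hqe : q = [] := (normalForm_unique (n := 0) (n' := n - 1) hq (red_nil hk)
        (by simpa using this)).1
      rw [hD, h0, hqe]
      simp
  · have hpl : p.getLast? = some z := by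
      have : p.getLast? = some y := by simp [hpe]
      rw [this, h6 y this]
    have hpne : p ≠ [] := by simp [hpe]
    have hD2' : ∀ n : ℤ, eval k (p ++ a₂) * eval k (b₂ ++ q) = delta k ^ n →
        wordDefect hk p q = 1 := fun n hn => hD2 _ (hpow n hn) hpne
    rw [hpl] at hD
    cases z with
    | true =>
      simp only [and_self, if_true, reduceCtorEq, false_and, if_false] at hD
      rw [hD]
      refine ⟨by omega, fun n hn _ => ?_⟩
      have := hD2' n hn
      omega
    | false =>
      simp only [reduceCtorEq, and_false, if_false, true_and] at hD
      by_cases hqt : q.head? = some true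
      · rw [if_pos hqt] at hD
        rw [hD]
        refine ⟨by omega, fun n hn _ => ?_⟩
        have := hD2' n hn
        omega
      · have h0 : wordDefect hk p q = 0 := by
          cases q with
          | nil => exact hnilq rfl
          | cons y q =>
            have hy : y = false := by simpa using hqt
            subst hy
            rw [wordDefect_of_red_append hk, hpl]
            · simp
            · refine hp.append hq fun u v hu hv => ?_
              rw [hpl] at hu
              simp_all
        rw [if_neg hqt, h0] at hD
        rw [hD]
        simp

/-- The signed depth is a quasimorphism with defect `0` or `1`. -/
lemma signedDepth_mul_bounds (hk : 0 < k) (g h : DihedralArtin (2 * k)) :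
    signedDepth hk (g * h) ≤ signedDepth hk g + signedDepth hk h ∧
      signedDepth hk g + signedDepth hk h ≤ signedDepth hk (g * h) + 1 := by
  obtain ⟨v, i, hv, rfl⟩ := exists_normalForm hk g
  obtain ⟨w, j, hw, rfl⟩ := exists_normalForm hk h
  have hprod : eval k v * delta k ^ i * (eval k w * delta k ^ j) =
      eval k v * eval k w * delta k ^ (i + j) := by
    rw [mul_assoc, ← mul_assoc (delta k ^ i), (delta_zpow_comm i _).eq, zpow_add]
    simp only [mul_assoc]
  have := (wordDefect_bounds hk _ rfl hv hw).1
  rw [wordDefect] at this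
  rw [hprod, signedDepth_mul_delta_zpow, signedDepth_eval_mul hk hv, signedDepth_eval_mul hk hw,
    mul_add]
  constructor <;> linarith

lemma signedDepth_add_inv (hk : 0 < k) {g : DihedralArtin (2 * k)}
    (hg : ∀ n : ℤ, g ≠ delta k ^ n) : signedDepth hk g + signedDepth hk g⁻¹ = 1 := by
  obtain ⟨v, i, hv, rfl⟩ := exists_normalForm hk g
  obtain ⟨w, j, hw, h⟩ := exists_normalForm hk (eval k v * delta k ^ i)⁻¹
  have hvne : v ≠ [] := by
    rintro rfl
    exact hg i (by simp)
  have hprod : eval k v * eval k w = delta k ^ (-(i + j)) := by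
    rw [inv_eq_iff_mul_eq_one, mul_assoc, ← mul_assoc (delta k ^ i),
      (delta_zpow_comm i _).eq, mul_assoc, ← zpow_add, ← mul_assoc] at h
    rw [zpow_neg]
    exact eq_inv_of_mul_eq_one_left h
  have := (wordDefect_bounds hk _ rfl hv hw).2 _ hprod hvne
  rw [wordDefect, hprod, signedDepth_delta_zpow] at this
  rw [h, signedDepth_eval_mul hk hv, signedDepth_eval_mul hk hw]
  linarith

lemma sBlocks_comp_false (hk : 0 < k) : sBlocks (comp k false) = k := by
  have := sBlocks_alt (k := k) false
  rw [← cons_comp hk, sBlocks] at this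
  simpa using this

lemma inv_gen_mul_eval (x : Bool) {w : List Bool} (hw : Red k w) (n : ℤ) :
    (gen k x)⁻¹ * (eval k w * delta k ^ n) = eval k (comp k x ++ w) * delta k ^ (n - 1) := by
  rw [inv_mul_eq_iff_eq_mul, eval_append, ← mul_assoc, ← mul_assoc, gen_mul_eval_comp hw.pos,
    (delta_comm _).eq, mul_assoc, ← zpow_one_add, add_sub_cancel]

lemma signedDepth_inv_genT_mul (hk : 0 < k) {g : DihedralArtin (2 * k)}
    (hg : ∀ n : ℤ, g ≠ delta k ^ n) :
    signedDepth hk ((gen k false)⁻¹ * g) = signedDepth hk g := by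
  obtain ⟨w, n, hw, rfl⟩ := exists_normalForm hk g
  rw [signedDepth_eval_mul hk hw]
  by_cases hx : w.head? = some false
  · obtain ⟨v, rfl⟩ : ∃ v, w = false :: v := List.head?_eq_some_iff.1 hx
    rw [eval_cons, mul_assoc, inv_mul_cancel_left,
      signedDepth_eval_mul hk (hw.of_infix (List.suffix_cons _ _).isInfix)]
    simp [sBlocks]
  · rw [inv_gen_mul_eval _ hw, signedDepth_eval_mul hk (hw.comp_append hx)]
    have hw' : w.head? = some true := by
      cases w with
      | nil => exact absurd (by simp) (hg n)
      | cons y w => simpa using hx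
    have := sBlocks_append (comp k false) w
    rw [getLast?_comp hk, hw', sBlocks_comp_false hk] at this
    simp only [Bool.not_false, and_self, if_true] at this
    zify at this
    linarith

/-- The normal form of a negative power of `t`. -/
lemma exists_genT_pow_inv_eq (hk : 0 < k) (n : ℕ) : ∃ w, Red k w ∧ w.head? ≠ some false ∧
    (gen k false ^ n)⁻¹ = eval k w * delta k ^ (-(n : ℤ)) := by
  induction n with
  | zero => exact ⟨[], red_nil hk, by simp, by simp⟩
  | succ n ih =>
    obtain ⟨w, hw, hx, h⟩ := ih
    refine ⟨comp k false ++ w, hw.comp_append hx, ?_, ?_⟩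
    · rw [List.head?_append_of_ne_nil _ (comp_ne_nil hk _), head?_comp hk]
      simp
    · rw [pow_succ, mul_inv_rev, h, inv_gen_mul_eval _ hw]
      congr 2
      push_cast
      ring

/-! ### The monoid -/

/-- The submonoid generated by `s` and `t`. -/
def posMonoid (k : ℕ) : Submonoid (DihedralArtin (2 * k)) :=
  Submonoid.closure {genS (2 * k), genT (2 * k)}

lemma gen_mem (x : Bool) : gen k x ∈ posMonoid k := by
  cases x
  · exact Submonoid.subset_closure (by simp [gen])
  · exact Submonoid.subset_closure (by simp [gen])

lemma eval_mem (w : List Bool) : eval k w ∈ posMonoid k := by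
  induction w with
  | nil => exact one_mem _
  | cons x w ih => rw [eval_cons]; exact mul_mem (gen_mem x) ih

lemma delta_mem : delta k ∈ posMonoid k := by
  rw [← eval_alt true]
  exact eval_mem _

lemma exists_eval_of_mem {g : DihedralArtin (2 * k)} (hg : g ∈ posMonoid k) :
    ∃ w, g = eval k w := by
  induction hg using Submonoid.closure_induction with
  | mem g hg =>
    rcases hg with rfl | rfl
    · exact ⟨[true], by simp [eval, gen]⟩
    · exact ⟨[false], by simp [eval, gen]⟩
  | one => exact ⟨[], rfl⟩
  | mul a b _ _ ha hb =>
    obtain ⟨v, rfl⟩ := ha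
    obtain ⟨w, rfl⟩ := hb
    exact ⟨v ++ w, (eval_append v w).symm⟩

lemma exists_normalForm_of_mem (hk : 0 < k) {g : DihedralArtin (2 * k)} (hg : g ∈ posMonoid k) :
    ∃ w, ∃ n : ℕ, Red k w ∧ g = eval k w * delta k ^ (n : ℤ) := by
  obtain ⟨v, rfl⟩ := exists_eval_of_mem hg
  induction v with
  | nil => exact ⟨[], 0, red_nil hk, by simp⟩
  | cons x v ih =>
    obtain ⟨w, n, hw, h⟩ := ih (eval_mem v)
    rw [eval_cons, h]
    by_cases hx : comp k x <+: w
    · obtain ⟨u, rfl⟩ := hx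
      refine ⟨u, n + 1, hw.right, ?_⟩
      rw [eval_append, ← mul_assoc, ← mul_assoc, gen_mul_eval_comp hk, (delta_comm _).eq,
        mul_assoc, ← zpow_one_add]
      congr 2
      push_cast
      ring
    · exact ⟨x :: w, n, hw.cons_of_not_prefix hx, by rw [eval_cons, mul_assoc]⟩

lemma eval_mul_delta_zpow_mem_iff {w : List Bool} (hw : Red k w) (n : ℤ) :
    eval k w * delta k ^ n ∈ posMonoid k ↔ 0 ≤ n := by
  constructor
  · intro h
    obtain ⟨v, j, hv, h⟩ := exists_normalForm_of_mem hw.pos h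
    rw [(normalForm_unique hw hv h).2]
    positivity
  · intro h
    lift n to ℕ using h
    rw [zpow_natCast]
    exact mul_mem (eval_mem w) (pow_mem delta_mem n)

/-- The unmovable elements are those spelled by reduced words. -/
lemma isUnmovable_iff (hk : 0 < k) {g : DihedralArtin (2 * k)} :
    IsUnmovable (posMonoid k) (delta k) g ↔ ∃ w, Red k w ∧ g = eval k w := by
  constructor
  · rintro ⟨hg, hg'⟩
    obtain ⟨w, n, hw, rfl⟩ := exists_normalForm_of_mem hk hg
    refine ⟨w, hw, ?_⟩
    rw [LeR, mul_assoc, ← zpow_sub_one, eval_mul_delta_zpow_mem_iff hw] at hg'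
    obtain rfl : n = 0 := by omega
    simp
  · rintro ⟨w, hw, rfl⟩
    refine ⟨eval_mem w, ?_⟩
    rw [LeR, ← zpow_neg_one, eval_mul_delta_zpow_mem_iff hw]
    simp

/-- A generator right-divides a reduced word only if it is its last letter. -/
lemma not_leR_gen {w : List Bool} {x : Bool} (hw : Red k w) (hx : w.getLast? ≠ some x) :
    ¬ LeR (posMonoid k) (gen k x) (eval k w) := by
  intro h
  obtain ⟨v, n, hv, h⟩ := exists_normalForm_of_mem hw.pos h
  rw [mul_inv_eq_iff_eq_mul, mul_assoc, (delta_zpow_comm _ _).eq, ← mul_assoc, ← eval_singleton,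
    ← eval_append] at h
  by_cases hvx : Red k (v ++ [x])
  · have := (normalForm_unique (n := 0) (n' := n) hw hvx (by simpa using h)).1
    rw [this] at hx
    simp at hx
  · obtain ⟨p, a₂, b₂, q, z, rfl, h2, h3, h4, h5, -⟩ :=
      exists_straddle hv (red_of_length_lt (by have := hw.pos; simp; omega)) hvx
    obtain ⟨rfl, rfl⟩ : b₂ = [x] ∧ q = [] := by
      cases b₂ <;> simp_all
    rw [List.append_assoc, h3, eval_append, eval_alt, mul_assoc, ← zpow_one_add] at h
    have := (normalForm_unique (n := 0) (n' := 1 + n) hw hv.left (by simpa using h)).2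
    omega

/-- If `s` and `t` both right-divide an element of the monoid, then so does `Δ`. -/
lemma leR_delta_of_leR_gen (hk : 0 < k) {g : DihedralArtin (2 * k)} (hg : g ∈ posMonoid k)
    (h : ∀ x, LeR (posMonoid k) (gen k x) g) : LeR (posMonoid k) (delta k) g := by
  by_contra hd
  obtain ⟨w, hw, rfl⟩ := (isUnmovable_iff hk).1 ⟨hg, hd⟩
  cases hl : w.getLast? with
  | none => exact not_leR_gen hw (x := true) (by simp [hl]) (h true)
  | some y => exact not_leR_gen hw (x := !y) (by simp [hl]) (h !y)

/-! ### The length homomorphism -/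

/-- The homomorphism to `ℤ` that sends both generators to `1`. -/
def lengthHom (k : ℕ) : DihedralArtin (2 * k) →* Multiplicative ℤ :=
  PresentedGroup.toGroup (f := fun _ : Letter => Multiplicative.ofAdd (1 : ℤ)) (by
    rintro _ rfl
    rw [map_mul, map_inv, map_altProd, map_altProd, FreeGroup.lift_apply_of,
      FreeGroup.lift_apply_of, mul_inv_cancel])

/-- The length of an element: the exponent sum of any word that spells it. -/
def len (g : DihedralArtin (2 * k)) : ℤ := (lengthHom k g).toAdd

@[simp] lemma len_one : len (1 : DihedralArtin (2 * k)) = 0 := by simp [len]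

@[simp] lemma len_mul (g h : DihedralArtin (2 * k)) : len (g * h) = len g + len h := by simp [len]

@[simp] lemma len_inv (g : DihedralArtin (2 * k)) : len g⁻¹ = -len g := by simp [len]

@[simp] lemma len_gen (x : Bool) : len (gen k x) = 1 := by
  have h : lengthHom k (gen k x) = Multiplicative.ofAdd (1 : ℤ) := by
    cases x <;> exact PresentedGroup.toGroup.of _
  rw [len, h]
  rfl

@[simp] lemma len_eval (w : List Bool) : len (eval k w) = w.length := by
  induction w with
  | nil => simp
  | cons x w ih => rw [eval_cons, len_mul, ih, len_gen, List.length_cons]; push_cast; ring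

lemma len_delta : len (delta k) = 2 * k := by
  rw [← eval_alt true, len_eval, length_alt]
  push_cast
  ring

lemma len_nonneg {g : DihedralArtin (2 * k)} (hg : g ∈ posMonoid k) : 0 ≤ len g := by
  obtain ⟨w, rfl⟩ := exists_eval_of_mem hg
  simp

lemma eq_one_of_len_le {g : DihedralArtin (2 * k)} (hg : g ∈ posMonoid k) (h : len g ≤ 0) :
    g = 1 := by
  obtain ⟨w, rfl⟩ := exists_eval_of_mem hg
  rw [len_eval] at h
  rw [List.length_eq_zero_iff.1 (by omega : w.length = 0), eval_nil]

lemma eq_one_of_inv_mem {g : DihedralArtin (2 * k)} (hg : g ∈ posMonoid k)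
    (hg' : g⁻¹ ∈ posMonoid k) : g = 1 := by
  have := len_nonneg hg'
  rw [len_inv] at this
  exact eq_one_of_len_le hg (by omega)

lemma isNoetherianMonoid_posMonoid : IsNoetherianMonoid (posMonoid k) := by
  have key : ∀ l : List (DihedralArtin (2 * k)), (∀ x ∈ l, x ∈ posMonoid k ∧ x ≠ 1) →
      (l.length : ℤ) ≤ len l.prod := by
    intro l
    induction l with
    | nil => simp
    | cons x l ih =>
      intro h
      have h1 := ih fun y hy => h y (List.mem_cons_of_mem _ hy)
      have h2 : 0 < len x := by
        obtain ⟨hx, hx1⟩ := h x List.mem_cons_self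
        by_contra hc
        exact hx1 (eq_one_of_len_le hx (by omega))
      rw [List.prod_cons, len_mul, List.length_cons]
      push_cast
      omega
  intro a _
  refine ⟨(len a).toNat + 1, by omega, ?_⟩
  rintro l hl rfl
  have := key l hl
  omega

/-! ### The lattice property -/

lemma leR_mul_right {G : Type*} [Group G] {M : Submonoid G} (g : G) {a b : G} :
    LeR M (a * g) (b * g) ↔ LeR M a b := by
  simp [LeR, mul_inv_rev, mul_assoc]

lemma LeR.trans {G : Type*} [Group G] {M : Submonoid G} {a b c : G} (h : LeR M a b)
    (h' : LeR M b c) : LeR M a c := by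
  have := mul_mem h' h
  rwa [← mul_assoc, inv_mul_cancel_right] at this

lemma LeR.refl {G : Type*} [Group G] {M : Submonoid G} (a : G) : LeR M a a := by
  simp [LeR, one_mem]

/-- The elements `a` and `b` have a least upper bound for right divisibility. -/
def HasJoin {G : Type*} [Group G] (M : Submonoid G) (a b : G) : Prop :=
  ∃ l, LeR M a l ∧ LeR M b l ∧ ∀ e, LeR M a e → LeR M b e → LeR M l e

lemma HasJoin.mul_right {G : Type*} [Group G] {M : Submonoid G} {a b : G} (h : HasJoin M a b)
    (g : G) : HasJoin M (a * g) (b * g) := by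
  obtain ⟨l, ha, hb, hl⟩ := h
  refine ⟨l * g, (leR_mul_right g).2 ha, (leR_mul_right g).2 hb, fun e hea heb => ?_⟩
  rw [← inv_mul_cancel_right e g, leR_mul_right] at hea heb ⊢
  exact hl _ hea heb

lemma exists_mul_gen_of_mem {a : DihedralArtin (2 * k)} (ha : a ∈ posMonoid k) (h1 : a ≠ 1) :
    ∃ a' ∈ posMonoid k, ∃ x, a = a' * gen k x := by
  obtain ⟨w, rfl⟩ := exists_eval_of_mem ha
  rcases List.eq_nil_or_concat w with rfl | ⟨v, x, h⟩
  · simp at h1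
  · refine ⟨eval k v, eval_mem v, x, ?_⟩
    rw [h, List.concat_eq_append, eval_append, eval_singleton]

lemma LeR.mem {G : Type*} [Group G] {M : Submonoid G} {a b : G} (h : LeR M a b) (ha : a ∈ M) :
    b ∈ M := by
  have := mul_mem h ha
  rwa [inv_mul_cancel_right] at this

/-- Two elements with a common left multiple have a least one, by induction on the length of the
common multiple: if their last letters differ, every common multiple is divisible by `Δ`, so the
two elements may be replaced by their joins with `Δ`, and `Δ` cancelled. -/
lemma hasJoin_of_leR (hk : 0 < k) (N : ℕ) : ∀ {a b c : DihedralArtin (2 * k)}, len c < N →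
    a ∈ posMonoid k → b ∈ posMonoid k → LeR (posMonoid k) a c → LeR (posMonoid k) b c →
    HasJoin (posMonoid k) a b := by
  induction N with
  | zero =>
    intro a b c hc ha _ hac _
    have := len_nonneg (hac.mem ha)
    simp at hc
    omega
  | succ N ih =>
    intro a b c hc ha hb hac hbc
    by_cases ha1 : a = 1
    · subst ha1
      exact ⟨b, by simpa [LeR] using hb, LeR.refl b, fun e _ h => h⟩
    by_cases hb1 : b = 1
    · subst hb1
      exact ⟨a, LeR.refl a, by simpa [LeR] using ha, fun e h _ => h⟩
    obtain ⟨a', ha', x, rfl⟩ := exists_mul_gen_of_mem ha ha1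
    obtain ⟨b', hb', y, rfl⟩ := exists_mul_gen_of_mem hb hb1
    have gen_le : ∀ (d e : DihedralArtin (2 * k)) z, d ∈ posMonoid k →
        LeR (posMonoid k) (d * gen k z) e → LeR (posMonoid k) (gen k z) e := fun d e z hd h =>
      LeR.trans (by simpa [LeR] using hd) h
    have cancel : ∀ (d e g : DihedralArtin (2 * k)), LeR (posMonoid k) (d * g) e →
        LeR (posMonoid k) d (e * g⁻¹) := fun d e g h => by
      rwa [← leR_mul_right g, inv_mul_cancel_right]
    have hlen : ∀ z, len (c * (gen k z)⁻¹) < N := fun z => by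
      push_cast at hc
      simp
      omega
    by_cases hxy : x = y
    · subst hxy
      exact (ih (hlen x) ha' hb' (cancel _ _ _ hac) (cancel _ _ _ hbc)).mul_right _
    have hdelta : ∀ e, LeR (posMonoid k) (a' * gen k x) e → LeR (posMonoid k) (b' * gen k y) e →
        LeR (posMonoid k) (delta k) e := fun e hea heb => by
      refine leR_delta_of_leR_gen hk (hea.mem ha) fun z => ?_
      by_cases hz : z = x
      · exact hz ▸ gen_le _ _ _ ha' hea
      · obtain rfl : z = y := by cases x <;> cases y <;> cases z <;> simp_all
        exact gen_le _ _ _ hb' heb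
    have hdc := hdelta c hac hbc
    have hjoin : ∀ d z, d ∈ posMonoid k → LeR (posMonoid k) (d * gen k z) c →
        HasJoin (posMonoid k) (d * gen k z) (delta k) := fun d z hd hdz => by
      rw [← eval_comp_mul_gen hk z]
      refine (ih (hlen z) hd (eval_mem _) (cancel _ _ _ hdz) (cancel _ _ _ ?_)).mul_right _
      rwa [eval_comp_mul_gen hk z]
    obtain ⟨A, hA1, hA2, hA3⟩ := hjoin a' x ha' hac
    obtain ⟨B, hB1, hB2, hB3⟩ := hjoin b' y hb' hbc
    have hAc := hA3 c hac hdc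
    have hBc := hB3 c hbc hdc
    have hJ : HasJoin (posMonoid k) (A * (delta k)⁻¹) (B * (delta k)⁻¹) := by
      refine ih (c := c * (delta k)⁻¹) ?_ hA2 hB2 ((leR_mul_right _).2 hAc)
        ((leR_mul_right _).2 hBc)
      push_cast at hc
      simp [len_delta]
      omega
    have hJ' := hJ.mul_right (delta k)
    rw [inv_mul_cancel_right, inv_mul_cancel_right] at hJ'
    obtain ⟨l, h1, h2, h3⟩ := hJ'
    refine ⟨l, hA1.trans h1, hB1.trans h2, fun e hea heb => ?_⟩
    have hde := hdelta e hea heb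
    exact h3 e (hA3 e hea hde) (hB3 e heb hde)

/-- Multiplication by a large power of `Δ` moves any element into the monoid. -/
lemma exists_mul_delta_zpow_mem (hk : 0 < k) (g : DihedralArtin (2 * k)) :
    ∃ N : ℤ, ∀ n, N ≤ n → g * delta k ^ n ∈ posMonoid k := by
  obtain ⟨w, j, hw, rfl⟩ := exists_normalForm hk g
  refine ⟨-j, fun n hn => ?_⟩
  rw [mul_assoc, ← zpow_add, eval_mul_delta_zpow_mem_iff hw]
  omega

lemma hasJoin (hk : 0 < k) (a b : DihedralArtin (2 * k)) : HasJoin (posMonoid k) a b := by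
  obtain ⟨N₁, h1⟩ := exists_mul_delta_zpow_mem hk a
  obtain ⟨N₂, h2⟩ := exists_mul_delta_zpow_mem hk b
  set n := max N₁ N₂
  have ha := h1 n (le_max_left _ _)
  have hb := h2 n (le_max_right _ _)
  obtain ⟨N₃, h3⟩ := exists_mul_delta_zpow_mem hk (a * delta k ^ n)⁻¹
  obtain ⟨N₄, h4⟩ := exists_mul_delta_zpow_mem hk (b * delta k ^ n)⁻¹
  have ha' := h3 (max N₃ N₄) (le_max_left _ _)
  have hb' := h4 (max N₃ N₄) (le_max_right _ _)
  rw [← (delta_zpow_comm _ _).eq] at ha' hb'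
  have := hasJoin_of_leR hk ((len (delta k ^ max N₃ N₄)).toNat + 1)
    (by push_cast; omega) ha hb ha' hb'
  simpa using this.mul_right (delta k ^ n)⁻¹

/-- The meet of two elements is the longest of their common lower bounds. -/
lemma isLatticeR_posMonoid (hk : 0 < k) : IsLatticeR (posMonoid k) := by
  intro a b
  refine ⟨?_, hasJoin hk a b⟩
  have hlen : ∀ {c d : DihedralArtin (2 * k)}, LeR (posMonoid k) c d → len c ≤ len d := by
    intro c d h
    have := len_nonneg h
    simp at this
    omega
  obtain ⟨z, ⟨c, ⟨hca, hcb⟩, hcz⟩, hmax⟩ := Int.exists_greatest_of_bdd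
    (P := fun z => ∃ c : DihedralArtin (2 * k),
      (LeR (posMonoid k) c a ∧ LeR (posMonoid k) c b) ∧ len c = z)
    ⟨len a, by rintro z ⟨c, ⟨hca, -⟩, rfl⟩; exact hlen hca⟩ (by
      obtain ⟨N₁, h1⟩ := exists_mul_delta_zpow_mem hk a
      obtain ⟨N₂, h2⟩ := exists_mul_delta_zpow_mem hk b
      refine ⟨_, (delta k ^ max N₁ N₂)⁻¹, ⟨?_, ?_⟩, rfl⟩
      · simpa [LeR] using h1 _ (le_max_left _ _)
      · simpa [LeR] using h2 _ (le_max_right _ _))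
  refine ⟨c, hca, hcb, fun d hda hdb => ?_⟩
  obtain ⟨l, hcl, hdl, hl⟩ := hasJoin hk c d
  have h1 := hmax _ ⟨l, ⟨hl a hca hda, hl b hcb hdb⟩, rfl⟩
  have h2 : l * c⁻¹ = 1 := eq_one_of_len_le hcl (by simp; omega)
  rwa [← mul_inv_eq_one.1 h2]

/-! ### The Garside structure and its parabolic substructures -/

lemma isBalanced_delta : IsBalanced (posMonoid k) (delta k) := by
  refine ⟨delta_mem, ?_⟩
  ext b
  rw [DivR, DivL, Set.mem_ofPred_eq, Set.mem_ofPred_eq, LeR, LeL, (delta_comm _).eq]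

lemma gen_mem_divR_delta (hk : 0 < k) (x : Bool) :
    gen k x ∈ DivR (posMonoid k) (delta k) := by
  refine ⟨gen_mem x, ?_⟩
  rw [LeR, ← eval_comp_mul_gen hk x, mul_inv_cancel_right]
  exact eval_mem _

lemma range_gen : Set.range (gen k) = {genS (2 * k), genT (2 * k)} := by
  ext g
  constructor
  · rintro ⟨x, rfl⟩
    cases x <;> simp [gen]
  · rintro (rfl | rfl)
    exacts [⟨true, rfl⟩, ⟨false, rfl⟩]

lemma isGarsideStructure (hk : 0 < k) : IsGarsideStructure (posMonoid k) (delta k) where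
  eq_one_of_mem_of_inv_mem _ := eq_one_of_inv_mem
  balanced := isBalanced_delta
  noetherian := isNoetherianMonoid_posMonoid
  finite_div := by
    refine ((List.finite_length_le Bool (2 * k)).image (eval k)).subset ?_
    rintro b ⟨hb, hb'⟩
    obtain ⟨w, rfl⟩ := exists_eval_of_mem hb
    refine ⟨w, ?_, rfl⟩
    have := len_nonneg hb'
    rw [len_mul, len_inv, len_delta, len_eval] at this
    simp only [Set.mem_ofPred_eq]
    omega
  closure_div := by
    refine le_antisymm (Submonoid.closure_le.2 fun b hb => hb.1) ?_
    conv_lhs => rw [posMonoid, ← range_gen]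
    refine Submonoid.closure_mono ?_
    rintro _ ⟨x, rfl⟩
    exact gen_mem_divR_delta hk x
  group_closure_div := by
    rw [eq_top_iff, ← closure_gen]
    refine Subgroup.closure_mono ?_
    rintro _ ⟨x, rfl⟩
    exact gen_mem_divR_delta hk x
  lattice := isLatticeR_posMonoid hk

/-- A generator is an atom of the monoid. -/
lemma eq_one_or_of_mul_eq_gen {a b : DihedralArtin (2 * k)} {x : Bool} (ha : a ∈ posMonoid k)
    (hb : b ∈ posMonoid k) (h : a * b = gen k x) : a = 1 ∨ b = 1 := by
  have h1 := congrArg len h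
  have h2 := len_nonneg ha
  have h3 := len_nonneg hb
  rw [len_mul, len_gen] at h1
  rcases lt_or_ge 0 (len a) with h4 | h4
  · exact Or.inr (eq_one_of_len_le hb (by omega))
  · exact Or.inl (eq_one_of_len_le ha h4)

lemma divR_gen (x : Bool) : DivR (posMonoid k) (gen k x) = {1, gen k x} := by
  ext b
  constructor
  · rintro ⟨hb, hb'⟩
    rcases eq_one_or_of_mul_eq_gen hb' hb (inv_mul_cancel_right _ _) with h | h
    · exact Or.inr (mul_inv_eq_one.1 h).symm
    · exact Or.inl h
  · rintro (rfl | rfl)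
    · exact ⟨one_mem _, by simpa [LeR] using gen_mem x⟩
    · exact ⟨gen_mem x, LeR.refl _⟩

lemma divL_gen (x : Bool) : DivL (posMonoid k) (gen k x) = {1, gen k x} := by
  ext b
  constructor
  · rintro ⟨hb, hb'⟩
    rcases eq_one_or_of_mul_eq_gen hb hb' (mul_inv_cancel_left _ _) with h | h
    · exact Or.inl h
    · exact Or.inr (inv_mul_eq_one.1 h)
  · rintro (rfl | rfl)
    · exact ⟨one_mem _, by simpa [LeL] using gen_mem x⟩
    · exact ⟨gen_mem x, by simp [LeL, one_mem]⟩

/-- The submonoid generated by one of the two generators. -/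
def genMonoid (k : ℕ) (x : Bool) : Submonoid (DihedralArtin (2 * k)) :=
  Submonoid.closure {gen k x}

lemma mem_genMonoid_iff {x : Bool} {g : DihedralArtin (2 * k)} :
    g ∈ genMonoid k x ↔ ∃ n : ℕ, gen k x ^ n = g := Submonoid.mem_closure_singleton

lemma genMonoid_le (x : Bool) : genMonoid k x ≤ posMonoid k := by
  rw [genMonoid, Submonoid.closure_le, Set.singleton_subset_iff]
  exact gen_mem x

lemma isParabolicSubstructure_gen (hk : 0 < k) (x : Bool) :
    IsParabolicSubstructure (posMonoid k) (delta k) (Subgroup.closure {gen k x})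
      (genMonoid k x) (gen k x) where
  balanced := ⟨gen_mem x, by rw [divR_gen, divL_gen]⟩
  group_eq := by rw [divR_gen, Subgroup.closure_insert_one]
  monoid_eq := by rw [divR_gen, Submonoid.closure_insert_one, genMonoid]
  div_eq := by
    rw [divR_gen]
    ext g
    constructor
    · rintro (rfl | rfl)
      · exact ⟨⟨one_mem _, by simpa [LeR] using delta_mem⟩, one_mem _⟩
      · exact ⟨gen_mem_divR_delta hk x, Submonoid.subset_closure rfl⟩
    · rintro ⟨⟨-, h⟩, hg⟩
      obtain ⟨n, rfl⟩ := mem_genMonoid_iff.1 hg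
      match n, h with
      | 0, _ => simp
      | 1, _ => simp
      | n + 2, h =>
        refine absurd ?_ (not_leR_gen (red_comp hk x) (x := x) (by simp [getLast?_comp hk]))
        have h' := mul_mem h (pow_mem (gen_mem x) n)
        rw [← eval_comp_mul_gen hk x, show n + 2 = n + 1 + 1 by rfl, pow_succ, pow_succ] at h'
        simpa [LeR, mul_assoc] using h'

lemma gen_not_mem_genMonoid (hk : 0 < k) (x : Bool) : gen k x ∉ genMonoid k (!x) := by
  intro h
  obtain ⟨n, hn⟩ := mem_genMonoid_iff.1 h
  cases n with
  | zero => simpa using congrArg len hn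
  | succ n =>
    refine not_leR_gen (k := k) (w := [x]) (x := !x)
      (red_of_length_lt (by simp; omega)) (by simp) ?_
    rw [eval_singleton, ← hn, LeR, pow_succ, mul_inv_cancel_right]
    exact pow_mem (gen_mem _) n

lemma genMonoid_ne (hk : 0 < k) (x : Bool) : genMonoid k x ≠ posMonoid k := fun h => by
  have := gen_not_mem_genMonoid hk (!x)
  rw [Bool.not_not, h] at this
  exact this (gen_mem _)

lemma evenTuple_isAdmissible (hk : 0 < k) : (evenTuple k).IsAdmissible where
  garside := isGarsideStructure hk
  parabolic_H := isParabolicSubstructure_gen hk true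
  parabolic_G₁ := isParabolicSubstructure_gen hk false
  N_ne := genMonoid_ne hk true
  M₁_ne := genMonoid_ne hk false
  closure_union := by
    change Submonoid.closure ((genMonoid k true : Set _) ∪ (genMonoid k false : Set _)) =
      posMonoid k
    rw [Submonoid.closure_union, Submonoid.closure_eq, Submonoid.closure_eq, genMonoid, genMonoid,
      ← Submonoid.closure_union, Set.singleton_union]
    rfl
  central g := (delta_comm g).eq
  central₁ g hg := by
    obtain ⟨n, rfl⟩ := Subgroup.mem_closure_singleton.1 hg
    exact ((Commute.refl (genT (2 * k))).zpow_right n).eq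

/-! ### Depth -/

lemma eq_one_of_isTail_one {N : Submonoid (DihedralArtin (2 * k))} (hN : N ≤ posMonoid k)
    {x : DihedralArtin (2 * k)} (h : IsTail (posMonoid k) N 1 x) : x = 1 := by
  have h' := (h.2 x h.1).2 (LeR.refl x)
  exact eq_one_of_inv_mem (hN h.1) (by simpa [LeR] using h')

lemma IsTail.unique {N : Submonoid (DihedralArtin (2 * k))} {a x y : DihedralArtin (2 * k)}
    (hx : IsTail (posMonoid k) N a x) (hy : IsTail (posMonoid k) N a y) : x = y := by
  have h1 : LeR (posMonoid k) x y := (hy.2 x hx.1).1 ((hx.2 x hx.1).2 (LeR.refl x))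
  have h2 : LeR (posMonoid k) y x := (hx.2 y hy.1).1 ((hy.2 y hy.1).2 (LeR.refl y))
  exact (mul_inv_eq_one.1 (eq_one_of_inv_mem h1 (by simpa [LeR] using h2))).symm

lemma eq_one_of_alternatingTails_one {N₁ N₂ : Submonoid (DihedralArtin (2 * k))}
    (h₁ : N₁ ≤ posMonoid k) (h₂ : N₂ ≤ posMonoid k) {l : List (DihedralArtin (2 * k))}
    (h : AlternatingTails (posMonoid k) N₁ N₂ 1 l) : ∀ x ∈ l, x = 1 := by
  induction l generalizing N₁ N₂ with
  | nil => simp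
  | cons y l ih =>
    obtain ⟨hy, hl⟩ := h
    obtain rfl := eq_one_of_isTail_one h₁ hy
    rw [mul_inv_cancel] at hl
    simpa using ih h₂ h₁ hl

lemma alternatingTails_length_unique {N₁ N₂ : Submonoid (DihedralArtin (2 * k))}
    (h₁ : N₁ ≤ posMonoid k) (h₂ : N₂ ≤ posMonoid k) {a : DihedralArtin (2 * k)}
    {l l' : List (DihedralArtin (2 * k))}
    (h : AlternatingTails (posMonoid k) N₁ N₂ a l) (hl : ∀ x ∈ l.getLast?, x ≠ 1)
    (h' : AlternatingTails (posMonoid k) N₁ N₂ a l') (hl' : ∀ x ∈ l'.getLast?, x ≠ 1) :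
    l.length = l'.length := by
  have key : ∀ {N₁ N₂ : Submonoid (DihedralArtin (2 * k))} {l : List (DihedralArtin (2 * k))},
      N₁ ≤ posMonoid k → N₂ ≤ posMonoid k → AlternatingTails (posMonoid k) N₁ N₂ 1 l →
      (∀ x ∈ l.getLast?, x ≠ 1) → l = [] := by
    intro N₁ N₂ l h₁ h₂ h hl
    rcases List.eq_nil_or_concat l with h0 | ⟨l₀, y, h0⟩
    · exact h0
    · have hy : l.getLast? = some y := by simp [h0]
      exact absurd (eq_one_of_alternatingTails_one h₁ h₂ h y (List.mem_of_getLast? hy))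
        (hl y hy)
  induction l generalizing N₁ N₂ a l' with
  | nil =>
    have ha : a = 1 := h
    rw [key h₁ h₂ (ha ▸ h') hl']
  | cons x l ih =>
    cases l' with
    | nil =>
      have ha : a = 1 := h'
      rw [key h₁ h₂ (ha ▸ h) hl]
    | cons y l' =>
      obtain rfl := h.1.unique h'.1
      rw [List.length_cons, List.length_cons, ih h₂ h₁ h.2 ?_ h'.2 ?_]
      · intro z hz
        refine hl z ?_
        cases l <;> simp_all
      · intro z hz
        refine hl' z ?_
        cases l' <;> simp_all

/-- The element `a` has an alternating form with `p` factors that begins, on the right, with a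
power of the generator `x`. -/
def HasForm (x : Bool) (a : DihedralArtin (2 * k)) (p : ℕ) : Prop :=
  ∃ l, IsAlternatingForm (posMonoid k) (genMonoid k (!x)) (genMonoid k x) a l ∧ l.length = p

lemma depth_one : (evenTuple k).depth 1 = 0 := by
  simp [OrderingTuple.depth, breadth]

lemma HasForm.depth_eq {a : DihedralArtin (2 * k)} {p : ℕ} (h : HasForm false a p) :
    (evenTuple k).depth a = p / 2 := by
  obtain ⟨l, hl, rfl⟩ := h
  by_cases ha : a = 1
  · subst ha
    have := alternatingTails_length_unique (genMonoid_le _) (genMonoid_le _) hl.1 hl.2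
      (l' := []) rfl (by simp)
    rw [this, depth_one]
    simp
  · have hb : breadth (evenTuple k).M (evenTuple k).N (evenTuple k).M₁ a = l.length := by
      have : {p | ∃ l' : List (DihedralArtin (2 * k)),
          IsAlternatingForm (evenTuple k).M (evenTuple k).N (evenTuple k).M₁ a l' ∧
            l'.length = p} = {l.length} := by
        ext p
        constructor
        · rintro ⟨l', hl', rfl⟩
          exact alternatingTails_length_unique (genMonoid_le false) (genMonoid_le true) hl'.1 hl'.2
            hl.1 hl.2
        · rintro rfl
          exact ⟨l, hl, rfl⟩
      rw [breadth, if_neg ha, this, csInf_singleton]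
    rw [OrderingTuple.depth, hb]
    split_ifs with hodd
    · obtain ⟨j, hj⟩ := hodd
      omega
    · rfl

lemma isTail_one {a : DihedralArtin (2 * k)} {x : Bool} (ha : a ∈ posMonoid k)
    (hx : ¬ LeR (posMonoid k) (gen k x) a) : IsTail (posMonoid k) (genMonoid k x) a 1 := by
  refine ⟨one_mem _, fun c hc => ?_⟩
  obtain ⟨n, rfl⟩ := mem_genMonoid_iff.1 hc
  cases n with
  | zero => simpa [LeR, one_mem] using ha
  | succ n =>
    constructor
    · intro h
      refine absurd (LeR.trans ?_ h) hx
      rw [LeR, pow_succ, mul_inv_cancel_right]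
      exact pow_mem (gen_mem x) n
    · intro h
      have h1 := eq_one_of_inv_mem (pow_mem (gen_mem x) (n + 1)) (by simpa [LeR] using h)
      simpa [LeR, h1] using ha

lemma IsTail.mul_gen {a b : DihedralArtin (2 * k)} {x : Bool} (ha : a ∈ posMonoid k)
    (h : IsTail (posMonoid k) (genMonoid k x) a b) :
    IsTail (posMonoid k) (genMonoid k x) (a * gen k x) (b * gen k x) := by
  have hb := genMonoid_le x h.1
  refine ⟨mul_mem h.1 (Submonoid.subset_closure rfl), fun c hc => ?_⟩
  obtain ⟨n, rfl⟩ := mem_genMonoid_iff.1 hc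
  cases n with
  | zero => simp [LeR, mul_mem ha (gen_mem x), mul_mem hb (gen_mem x)]
  | succ n =>
    rw [pow_succ, leR_mul_right, leR_mul_right]
    exact h.2 _ (mem_genMonoid_iff.2 ⟨n, rfl⟩)

lemma gen_ne_one (x : Bool) : gen k x ≠ 1 := fun h => by
  simpa using congrArg len h

lemma mul_gen_ne_one {a : DihedralArtin (2 * k)} (ha : a ∈ posMonoid k) (x : Bool) :
    a * gen k x ≠ 1 := fun h => by
  have h1 := congrArg len h
  have h2 := len_nonneg ha
  simp at h1
  omega

/-- Multiplication on the right by `x` extends the first factor of an alternating form. -/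
lemma HasForm.mul_gen {a : DihedralArtin (2 * k)} {x : Bool} {p : ℕ} (ha : a ∈ posMonoid k)
    (h : HasForm x a p) : HasForm x (a * gen k x) (max 1 p) := by
  obtain ⟨l, ⟨hl, hlast⟩, rfl⟩ := h
  cases l with
  | nil =>
    have ha1 : a = 1 := hl
    subst ha1
    have ht : IsTail (posMonoid k) (genMonoid k x) 1 1 := isTail_one (one_mem _) fun h => by
      have := len_nonneg h
      simp at this
    have ht' := ht.mul_gen ha
    rw [one_mul] at ht' ⊢
    exact ⟨[gen k x], ⟨⟨ht', mul_inv_cancel _⟩, by simp [gen_ne_one]⟩, rfl⟩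
  | cons b l =>
    obtain ⟨hb, hl⟩ := hl
    refine ⟨(b * gen k x) :: l, ⟨⟨hb.mul_gen ha, ?_⟩, ?_⟩, by simp⟩
    · rwa [mul_inv_rev, mul_assoc, mul_inv_cancel_left]
    · cases l with
      | nil => simpa using mul_gen_ne_one (genMonoid_le x hb.1) x
      | cons c l => simpa using hlast

lemma HasForm.cons_one {a : DihedralArtin (2 * k)} {x : Bool} {p : ℕ} (ha : a ∈ posMonoid k)
    (hx : ¬ LeR (posMonoid k) (gen k !x) a) (h : HasForm x a p) (hp : p ≠ 0) :
    HasForm (!x) a (p + 1) := by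
  obtain ⟨l, ⟨hl, hlast⟩, rfl⟩ := h
  refine ⟨1 :: l, ⟨⟨isTail_one ha hx, ?_⟩, ?_⟩, rfl⟩
  · rw [inv_one, mul_one, Bool.not_not]
    exact hl
  · cases l with
    | nil => simp at hp
    | cons b l => simpa using hlast

/-- The alternating forms of an unmovable element are read off from its reduced word. The
correction terms account for a form that begins with an empty block of letters `s`. -/
lemma exists_hasForm_eval (w : List Bool) (hw : Red k w) (y : Bool) :
    ∃ p, HasForm y (eval k w) p ∧ (p = 0 ↔ w = []) ∧
      (p + if y = true then 1 else 0) / 2 =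
        sBlocks w + if y = true ∧ w.getLast? = some false then 1 else 0 := by
  induction w using List.reverseRecOn generalizing y with
  | nil =>
    refine ⟨0, ⟨[], ⟨rfl, by simp⟩, rfl⟩, by simp, ?_⟩
    cases y <;> simp [sBlocks]
  | append_singleton w z ih =>
    obtain ⟨p, hp, hp0, hps⟩ := ih hw.left z
    have hform := hp.mul_gen (eval_mem w)
    rw [← eval_singleton, ← eval_append] at hform
    have hs := sBlocks_append w [z]
    by_cases hyz : y = z
    · subst hyz
      refine ⟨max 1 p, hform, by simp, ?_⟩
      rcases List.eq_nil_or_concat w with hw0 | ⟨v, u, hv⟩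
      · have hp00 := hp0.2 hw0
        subst hw0
        subst hp00
        cases y <;> simp [sBlocks]
      · have hp1 : p ≠ 0 := fun h => by simp [hp0.1 h] at hv
        have hlast : w.getLast? = some u := by simp [hv]
        rw [max_eq_right (by omega)]
        cases y <;> cases u <;> simp [hlast, sBlocks] at hs hps ⊢ <;> omega
    · obtain rfl : y = !z := by cases y <;> cases z <;> simp_all
      refine ⟨max 1 p + 1, hform.cons_one (eval_mem _) (not_leR_gen hw (by simp)) (by omega),
        by simp, ?_⟩
      rcases List.eq_nil_or_concat w with hw0 | ⟨v, u, hv⟩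
      · have hp00 := hp0.2 hw0
        subst hw0
        subst hp00
        cases z <;> simp [sBlocks]
      · have hp1 : p ≠ 0 := fun h => by simp [hp0.1 h] at hv
        have hlast : w.getLast? = some u := by simp [hv]
        rw [max_eq_right (by omega)]
        cases z <;> cases u <;> simp [hlast, sBlocks] at hs hps ⊢ <;> omega

lemma depth_eval {w : List Bool} (hw : Red k w) : (evenTuple k).depth (eval k w) = sBlocks w := by
  obtain ⟨p, hp, -, h⟩ := exists_hasForm_eval w hw false
  rw [hp.depth_eq]
  simpa using h

lemma signedDepth_genT_pow_inv (hk : 0 < k) {n : ℕ} (hn : n ≠ 0) :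
    signedDepth hk (gen k false ^ n)⁻¹ = 1 := by
  have key : signedDepth hk (gen k false)⁻¹ = 1 := by
    have := inv_gen_mul_eval false (red_nil hk) 0
    rw [eval_nil, zpow_zero, mul_one, mul_one, List.append_nil] at this
    rw [this, signedDepth_eval_mul hk (red_comp hk _), sBlocks_comp_false hk]
    push_cast
    ring
  obtain ⟨n, rfl⟩ := Nat.exists_eq_succ_of_ne_zero hn
  induction n with
  | zero => simpa using key
  | succ n ih =>
    rw [pow_succ, mul_inv_rev, signedDepth_inv_genT_mul hk, ih (by omega)]
    intro j hj
    -- If a negative power of `t` were a power of `Δ`, its reduced word would be empty and its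
    -- signed depth would not be positive.
    obtain ⟨w, hw, -, h⟩ := exists_genT_pow_inv_eq hk (n + 1)
    have hw0 : w = [] := (normalForm_unique hw (red_nil hk)
      (n' := j) (by rw [← h, eval_nil, one_mul]; exact hj)).1
    have h1 := ih (by omega)
    rw [hj, signedDepth_delta_zpow] at h1
    rw [hj, hw0, eval_nil, one_mul] at h
    have h2 := congrArg (signedDepth hk) h
    rw [signedDepth_delta_zpow, signedDepth_delta_zpow, h1] at h2
    have h3 : (0 : ℤ) ≤ (k - 1 : ℤ) * (n + 1) := by
      have : (0 : ℤ) ≤ (k - 1 : ℤ) := by omega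
      positivity
    push_cast at h2
    linarith

/-- The alternating form of `Δ ^ n` has `t ^ n` as its first factor, and continues as the form of
the unmovable part of `t ^ (-n)`. -/
lemma depth_delta_pow (hk : 0 < k) {n : ℕ} (hn : n ≠ 0) :
    ((evenTuple k).depth (delta k ^ n) : ℤ) = (k - 1) * n + 1 := by
  obtain ⟨w, hw, -, h⟩ := exists_genT_pow_inv_eq hk n
  have hS := signedDepth_genT_pow_inv hk hn
  rw [h, signedDepth_eval_mul hk hw] at hS
  obtain ⟨p, hp, hp0, hps⟩ := exists_hasForm_eval w hw false
  have hw0 : w ≠ [] := by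
    rintro rfl
    have h3 : (0 : ℤ) ≤ (k - 1 : ℤ) * n := by
      have : (0 : ℤ) ≤ (k - 1 : ℤ) := by omega
      positivity
    simp [sBlocks] at hS
    linarith
  have hp1 : max 1 p = p := max_eq_right (Nat.one_le_iff_ne_zero.2 fun h => hw0 (hp0.1 h))
  have hpow : ∀ j : ℕ, HasForm false (eval k w * gen k false ^ j) p := by
    intro j
    induction j with
    | zero => simpa using hp
    | succ j ih =>
      have := ih.mul_gen (mul_mem (eval_mem w) (pow_mem (gen_mem false) j))
      rwa [hp1, mul_assoc, ← pow_succ] at this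
  have hdelta : delta k ^ n = eval k w * gen k false ^ n := by
    rw [inv_eq_iff_eq_inv, mul_inv_rev, zpow_neg, inv_inv, zpow_natCast] at h
    rw [h, ((delta_comm (eval k w)⁻¹).pow_left n).eq, mul_inv_cancel_left]
  rw [hdelta, (hpow n).depth_eq]
  simp only [reduceCtorEq, if_false, Nat.add_zero, false_and] at hps
  rw [hps]
  linarith

/-! ### The powers of `t` -/

lemma red_replicate (hk : 0 < k) (n : ℕ) (x : Bool) : Red k (List.replicate n x) := by
  induction n with
  | zero => exact red_nil hk
  | succ n ih =>
    have h1 : Red k [x] := red_of_length_lt (by simp; omega)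
    refine h1.append ih fun y z hy hz => ?_
    have := List.eq_of_mem_replicate (List.mem_of_mem_head? (by simpa using hz))
    simp_all

lemma signedDepth_genT_pow (hk : 0 < k) (n : ℕ) : signedDepth hk (gen k false ^ n) = 0 := by
  rw [← eval_replicate, signedDepth_eval hk (red_replicate hk n _), sBlocks_replicate]
  rfl

lemma signedDepth_genT_zpow (hk : 0 < k) (i : ℤ) :
    signedDepth hk (gen k false ^ i) = if i < 0 then 1 else 0 := by
  split_ifs with hi
  · obtain ⟨n, rfl⟩ : ∃ n : ℕ, i = -n := ⟨i.natAbs, by omega⟩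
    rw [zpow_neg, zpow_natCast, signedDepth_genT_pow_inv hk (by omega)]
  · obtain ⟨n, rfl⟩ : ∃ n : ℕ, i = n := ⟨i.natAbs, by omega⟩
    rw [zpow_natCast, signedDepth_genT_pow]

/-- Multiplication by powers of `t` on the left preserves the signed depth outside the subgroup
generated by `t` and `Δ`. -/
lemma signedDepth_genT_zpow_mul (hk : 0 < k) {g : DihedralArtin (2 * k)}
    (hg : ∀ i j : ℤ, g ≠ gen k false ^ i * delta k ^ j) (i : ℤ) :
    signedDepth hk (gen k false ^ i * g) = signedDepth hk g := by
  have hne : ∀ i n : ℤ, gen k false ^ i * g ≠ delta k ^ n := fun i n h =>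
    hg (-i) n (by rw [← h, zpow_neg, inv_mul_cancel_left])
  have step : ∀ i : ℤ, signedDepth hk (gen k false ^ (i - 1) * g) =
      signedDepth hk (gen k false ^ i * g) := fun i => by
    rw [← signedDepth_inv_genT_mul hk (hne i), ← mul_assoc, ← zpow_neg_one, ← zpow_add,
      neg_add_eq_sub]
  induction i with
  | zero => simp
  | succ n ih => rw [← step, add_sub_cancel_right, ih]
  | pred n ih => rw [step, ih]

lemma inv_ne_genT_zpow_mul {g : DihedralArtin (2 * k)}
    (hg : ∀ i j : ℤ, g ≠ gen k false ^ i * delta k ^ j) (i j : ℤ) :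
    g⁻¹ ≠ gen k false ^ i * delta k ^ j := fun h =>
  hg (-i) (-j) (by
    rw [← inv_inv g, h, mul_inv_rev, ← zpow_neg, ← zpow_neg, (delta_zpow_comm _ _).eq])

lemma signedDepth_inv (hk : 0 < k) {g : DihedralArtin (2 * k)}
    (hg : ∀ i j : ℤ, g ≠ gen k false ^ i * delta k ^ j) :
    signedDepth hk g⁻¹ = 1 - signedDepth hk g := by
  have := signedDepth_add_inv hk (g := g) fun n hn => hg 0 n (by simpa using hn)
  linarith

lemma signedDepth_mul_genT_zpow (hk : 0 < k) {g : DihedralArtin (2 * k)}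
    (hg : ∀ i j : ℤ, g ≠ gen k false ^ i * delta k ^ j) (i : ℤ) :
    signedDepth hk (g * gen k false ^ i) = signedDepth hk g := by
  have h1 : ∀ a b : ℤ, g * gen k false ^ i ≠ gen k false ^ a * delta k ^ b := fun a b h =>
    hg (a - i) b (by
      rw [eq_mul_inv_of_mul_eq h, mul_assoc, (delta_zpow_comm b _).eq, ← mul_assoc, ← zpow_neg,
        ← zpow_add, sub_eq_add_neg])
  have h2 := signedDepth_inv hk h1
  rw [mul_inv_rev, ← zpow_neg, signedDepth_genT_zpow_mul hk (inv_ne_genT_zpow_mul hg),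
    signedDepth_inv hk hg] at h2
  linarith

/-! ### Conditions A and B -/

lemma evenTuple_conditionA (hk : 2 ≤ k) : (evenTuple k).ConditionA (k - 1) := by
  refine ⟨by omega, fun n hn => ?_⟩
  have := depth_delta_pow (by omega : 0 < k) (n := n) (by omega)
  zify [(by omega : 1 ≤ k)]
  exact this

lemma signedDepth_of_isUnmovable (hk : 0 < k) {a : DihedralArtin (2 * k)}
    (ha : IsUnmovable (posMonoid k) (delta k) a) :
    signedDepth hk a = (evenTuple k).depth a := by
  obtain ⟨w, hw, rfl⟩ := (isUnmovable_iff hk).1 ha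
  rw [signedDepth_eval hk hw, depth_eval hw]

lemma mul_delta_zpow_isUnmovable_iff (hk : 0 < k) {a : DihedralArtin (2 * k)}
    (ha : IsUnmovable (posMonoid k) (delta k) a) (n : ℤ) :
    IsUnmovable (posMonoid k) (delta k) (a * delta k ^ n) ↔ n = 0 := by
  constructor
  · intro h
    obtain ⟨w, hw, rfl⟩ := (isUnmovable_iff hk).1 ha
    obtain ⟨v, hv, h⟩ := (isUnmovable_iff hk).1 h
    exact (normalForm_unique (n' := 0) hw hv (by simpa using h)).2
  · rintro rfl
    simpa using ha

lemma isUnmovable_genT_pow (hk : 0 < k) (n : ℕ) :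
    IsUnmovable (posMonoid k) (delta k) (gen k false ^ n) :=
  (isUnmovable_iff hk).2 ⟨_, red_replicate hk n false, (eval_replicate n false).symm⟩

lemma theta_pow_mul (n q : ℕ) : (evenTuple k).theta ^ n * gen k false ^ q =
    gen k false ^ ((q : ℤ) - n) * delta k ^ (n : ℤ) := by
  have h : (evenTuple k).theta = delta k * (gen k false)⁻¹ := rfl
  rw [h, (delta_comm _).mul_pow, inv_pow, mul_assoc, zpow_natCast, ((delta_comm _).pow_left n).eq,
    sub_eq_neg_add, zpow_add, zpow_neg, zpow_natCast, zpow_natCast]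

/-- A theta element has the form `t ^ i Δ ^ j` with `j ≥ 1`; for `i ≥ 0` it would be divisible by
`Δ`. -/
lemma exists_of_mem_thetaSet (hk : 0 < k) {a : DihedralArtin (2 * k)}
    (ha : IsUnmovable (posMonoid k) (delta k) a) (h : a ∈ (evenTuple k).thetaSet) :
    ∃ i j : ℤ, i < 0 ∧ a = gen k false ^ i * delta k ^ j := by
  obtain ⟨n, hn, a₀, ha₀, rfl⟩ := h
  obtain ⟨q, rfl⟩ := mem_genMonoid_iff.1 (show a₀ ∈ genMonoid k false from ha₀)
  rw [theta_pow_mul] at ha ⊢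
  refine ⟨_, _, ?_, rfl⟩
  by_contra hc
  obtain ⟨d, hd⟩ : ∃ d : ℕ, (q : ℤ) - n = d := ⟨q - n, by omega⟩
  rw [hd, zpow_natCast, mul_delta_zpow_isUnmovable_iff hk (isUnmovable_genT_pow hk d)] at ha
  omega

lemma mem_thetaBar (hk : 0 < k) {i j : ℤ}
    (ha : IsUnmovable (posMonoid k) (delta k) (gen k false ^ i * delta k ^ j)) :
    gen k false ^ i * delta k ^ j ∈ (evenTuple k).thetaBar := by
  rcases lt_or_ge i 0 with hi | hi
  · left
    obtain ⟨n, rfl⟩ : ∃ n : ℕ, i = -n := ⟨i.natAbs, by omega⟩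
    obtain ⟨w, hw, -, h⟩ := exists_genT_pow_inv_eq hk n
    have hj : j = n := by
      rw [zpow_neg, zpow_natCast, h, mul_assoc, ← zpow_add, mul_delta_zpow_isUnmovable_iff hk
        ((isUnmovable_iff hk).2 ⟨w, hw, rfl⟩)] at ha
      omega
    refine ⟨n, by omega, 1, one_mem _, ?_⟩
    have := theta_pow_mul (k := k) n 0
    rw [pow_zero] at this
    rw [this, hj, Nat.cast_zero, zero_sub]
  · right
    lift i to ℕ using hi
    rw [zpow_natCast] at ha ⊢
    rw [(mul_delta_zpow_isUnmovable_iff hk (isUnmovable_genT_pow hk i) j).1 ha, zpow_zero, mul_one]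
    have hmem : gen k false ^ i ∈ genMonoid k false := mem_genMonoid_iff.2 ⟨i, rfl⟩
    exact hmem

lemma evenTuple_conditionB (hk : 2 ≤ k) : (evenTuple k).ConditionB (k - 1) := by
  have hk0 : 0 < k := by omega
  refine ⟨by omega, fun a b ha hb hab c r hc => ?_⟩
  obtain ⟨hc, hcr⟩ := hc
  change a * b = c * delta k ^ r at hcr
  have hsa := signedDepth_of_isUnmovable hk0 ha
  have hsb := signedDepth_of_isUnmovable hk0 hb
  have hsab : signedDepth hk0 (a * b) = (evenTuple k).depth c + ((k : ℤ) - 1) * r := by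
    rw [hcr, signedDepth_mul_delta_zpow, signedDepth_of_isUnmovable hk0 hc]
  have hbd := signedDepth_mul_bounds hk0 a b
  -- Elements of the subgroup generated by `t` and `Δ` that are unmovable lie in `Θ ∪ M₁`.
  have htype : ∀ u, IsUnmovable (posMonoid k) (delta k) u → u ∉ (evenTuple k).thetaBar →
      ∀ i j : ℤ, u ≠ gen k false ^ i * delta k ^ j := by
    rintro _ hu hu' i j rfl
    exact hu' (mem_thetaBar hk0 hu)
  refine ⟨signedDepth hk0 a + signedDepth hk0 b - signedDepth hk0 (a * b), by omega, ?_, ?_⟩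
  · push_cast [(by omega : 1 ≤ k)]
    rw [hsab, hsa, hsb]
    ring
  · rintro (h | h | h)
    · have hb' := htype b hb fun hb' => hab ⟨Or.inl h, hb'⟩
      obtain ⟨i, j, hi, rfl⟩ := exists_of_mem_thetaSet hk0 ha h
      rw [mul_assoc, (delta_zpow_comm j b).eq, ← mul_assoc, signedDepth_mul_delta_zpow,
        signedDepth_mul_delta_zpow, signedDepth_genT_zpow_mul hk0 hb', signedDepth_genT_zpow,
        if_pos hi]
      ring
    · have ha' := htype a ha fun ha' => hab ⟨ha', Or.inl h⟩
      obtain ⟨i, j, hi, rfl⟩ := exists_of_mem_thetaSet hk0 hb h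
      rw [← mul_assoc, signedDepth_mul_delta_zpow, signedDepth_mul_delta_zpow,
        signedDepth_mul_genT_zpow hk0 ha', signedDepth_genT_zpow, if_pos hi]
      ring
    · obtain ⟨n, rfl⟩ := mem_genMonoid_iff.1 (show c ∈ genMonoid k false from h)
      have hb' : ∀ i j : ℤ, b ≠ gen k false ^ i * delta k ^ j := by
        rintro i j rfl
        refine hab ⟨?_, mem_thetaBar hk0 hb⟩
        have : a = gen k false ^ ((n : ℤ) - i) * delta k ^ (r - j) := by
          rw [eq_mul_inv_of_mul_eq hcr, mul_inv_rev, ← zpow_neg, ← zpow_neg, mul_assoc,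
            ← mul_assoc (delta k ^ r), ← zpow_add, (delta_zpow_comm _ _).eq, ← mul_assoc,
            ← zpow_natCast, ← zpow_add, sub_eq_add_neg, sub_eq_add_neg]
        rw [this] at ha ⊢
        exact mem_thetaBar hk0 ha
      have h1 : a = gen k false ^ (n : ℤ) * b⁻¹ * delta k ^ r := by
        rw [eq_mul_inv_of_mul_eq hcr, zpow_natCast, mul_assoc, mul_assoc,
          (delta_zpow_comm _ _).eq]
      have h2 : signedDepth hk0 a = 1 - signedDepth hk0 b + (k - 1) * r := by
        rw [h1, signedDepth_mul_delta_zpow,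
          signedDepth_genT_zpow_mul hk0 (inv_ne_genT_zpow_mul hb'), signedDepth_inv hk0 hb']
      rw [h2, hcr, signedDepth_mul_delta_zpow, signedDepth_genT_pow]
      ring

/-! ### The Dehornoy structure -/

lemma mem_G₁_iff {g : DihedralArtin (2 * k)} :
    g ∈ (evenTuple k).G₁ ↔ ∃ i : ℤ, gen k false ^ i = g := Subgroup.mem_closure_singleton

lemma isNegative_iff (hk : 2 ≤ k) (g : DihedralArtin (2 * k)) :
    (evenTuple k).IsNegative g ↔
      signedDepth (by omega : 0 < k) g ≤ 0 ∧ g ∉ (evenTuple k).G₁ := by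
  have hk0 : 0 < k := by omega
  constructor
  · rintro ⟨a, n, ⟨ha, hg⟩, hn, hd⟩
    change g = a * delta k ^ (-(n : ℤ)) at hg
    have hle : signedDepth hk0 g ≤ 0 := by
      have h1 := depth_delta_pow hk0 (n := n) (by omega)
      have h2 : ((evenTuple k).depth a : ℤ) < (evenTuple k).depth (delta k ^ n) :=
        Nat.cast_lt.2 hd
      rw [hg, signedDepth_mul_delta_zpow, signedDepth_of_isUnmovable hk0 ha]
      linarith
    refine ⟨hle, fun hG => ?_⟩
    obtain ⟨i, hi⟩ := mem_G₁_iff.1 hG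
    rw [← hi, signedDepth_genT_zpow] at hle
    have hi0 : 0 ≤ i := by
      by_contra hc
      rw [if_pos (by omega)] at hle
      omega
    lift i to ℕ using hi0
    rw [hg, zpow_natCast] at hi
    have := (mul_delta_zpow_isUnmovable_iff hk0 ha _).1 (hi ▸ isUnmovable_genT_pow hk0 i)
    omega
  · rintro ⟨hle, hG⟩
    obtain ⟨w, n, hw, rfl⟩ := exists_normalForm hk0 g
    rw [signedDepth_eval_mul hk0 hw] at hle
    have hn : n < 0 := by
      by_contra hc
      have h1 : (0 : ℤ) < k - 1 := by omega
      have h2 : 0 ≤ ((k : ℤ) - 1) * n := mul_nonneg h1.le (by omega)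
      have h3 : sBlocks w = 0 := by omega
      have h4 : n = 0 := by
        have : ((k : ℤ) - 1) * n = 0 := by omega
        rcases mul_eq_zero.1 this with h | h <;> omega
      refine hG (mem_G₁_iff.2 ⟨w.length, ?_⟩)
      rw [h4, eq_replicate_of_sBlocks_eq_zero h3, eval_replicate]
      simp
    obtain ⟨m, rfl⟩ : ∃ m : ℕ, n = -m := ⟨n.natAbs, by omega⟩
    refine ⟨eval k w, m, ⟨(isUnmovable_iff hk0).2 ⟨w, hw, rfl⟩, rfl⟩, by omega, ?_⟩
    have h1 := depth_delta_pow hk0 (n := m) (by omega)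
    rw [depth_eval hw]
    change sBlocks w < (evenTuple k).depth (delta k ^ m)
    zify
    rw [h1]
    linarith

/-- Left multiplication by `G₁` preserves the sign of an element outside `G₁`. -/
lemma one_le_signedDepth_genT_zpow_mul_iff (hk : 2 ≤ k) (hk0 : 0 < k)
    {g : DihedralArtin (2 * k)} (hg : g ∉ (evenTuple k).G₁) (i : ℤ) :
    1 ≤ signedDepth hk0 (gen k false ^ i * g) ↔ 1 ≤ signedDepth hk0 g := by
  by_cases h : ∀ i j : ℤ, g ≠ gen k false ^ i * delta k ^ j
  · rw [signedDepth_genT_zpow_mul hk0 h]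
  push Not at h
  obtain ⟨l, j, rfl⟩ := h
  have hj : j ≠ 0 := by
    rintro rfl
    exact hg (mem_G₁_iff.2 ⟨l, by simp⟩)
  have key : ∀ l : ℤ, 1 ≤ signedDepth hk0 (gen k false ^ l * delta k ^ j) ↔ 0 < j := by
    intro l
    have h1 : (1 : ℤ) ≤ k - 1 := by omega
    rw [signedDepth_mul_delta_zpow, signedDepth_genT_zpow]
    constructor
    · intro h
      by_contra hc
      have : ((k : ℤ) - 1) * j ≤ -1 := by nlinarith [show j ≤ -1 by omega]
      split_ifs at h <;> omega
    · intro h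
      have : 1 ≤ ((k : ℤ) - 1) * j := by nlinarith
      split_ifs <;> omega
  rw [← mul_assoc, ← zpow_add, key, key]

lemma mem_positives_iff (hk : 2 ≤ k) (hk0 : 0 < k) (g : DihedralArtin (2 * k)) :
    g ∈ (evenTuple k).positives ↔ 1 ≤ signedDepth hk0 g ∧ g ∉ (evenTuple k).G₁ := by
  rw [OrderingTuple.positives, Set.mem_ofPred_eq, isNegative_iff hk, inv_mem_iff]
  refine and_congr_left fun hg => ?_
  by_cases h : ∀ n : ℤ, g ≠ delta k ^ n
  · have := signedDepth_add_inv hk0 h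
    constructor <;> intro h <;> linarith
  push Not at h
  obtain ⟨n, rfl⟩ := h
  have hn : n ≠ 0 := by
    rintro rfl
    exact hg (by simp)
  have h1 : (1 : ℤ) ≤ k - 1 := by omega
  rw [← zpow_neg, signedDepth_delta_zpow, signedDepth_delta_zpow]
  constructor
  · intro h
    have : 0 < n := by
      by_contra hc
      nlinarith [show n ≤ -1 by omega]
    nlinarith
  · intro h
    nlinarith

lemma mul_mem_positives_of_mem_G₁ (hk : 2 ≤ k) {g α : DihedralArtin (2 * k)}
    (hg : g ∈ (evenTuple k).G₁) (hα : α ∈ (evenTuple k).positives) :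
    g * α ∈ (evenTuple k).positives := by
  have hk0 : 0 < k := by omega
  rw [mem_positives_iff hk hk0] at hα ⊢
  refine ⟨?_, fun h => hα.2 ((Subgroup.mul_mem_cancel_left _ hg).1 h)⟩
  obtain ⟨i, rfl⟩ := mem_G₁_iff.1 hg
  exact (one_le_signedDepth_genT_zpow_mul_iff hk hk0 hα.2 i).2 hα.1

lemma mem_positives_mul_of_mem_G₁ (hk : 2 ≤ k) {g α : DihedralArtin (2 * k)}
    (hg : g ∈ (evenTuple k).G₁) (hα : α ∈ (evenTuple k).positives) :
    α * g ∈ (evenTuple k).positives := by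
  have hk0 : 0 < k := by omega
  have hα' : (evenTuple k).IsNegative α⁻¹ := hα
  change (evenTuple k).IsNegative (α * g)⁻¹
  rw [isNegative_iff hk] at hα' ⊢
  rw [mul_inv_rev]
  refine ⟨?_, fun h => hα'.2 ((Subgroup.mul_mem_cancel_left _ (inv_mem hg)).1 h)⟩
  obtain ⟨i, rfl⟩ := mem_G₁_iff.1 hg
  have := one_le_signedDepth_genT_zpow_mul_iff hk hk0 hα'.2 (-i)
  rw [zpow_neg] at this
  have h1 := hα'.1
  omega

lemma disjoint_positives_negatives (hk : 2 ≤ k) :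
    Disjoint (evenTuple k).positives (evenTuple k).negatives := by
  have hk0 : 0 < k := by omega
  rw [Set.disjoint_left]
  intro g hg hg'
  have h1 := ((mem_positives_iff hk hk0 g).1 hg).1
  have h2 := ((isNegative_iff hk g).1 hg').1
  omega

lemma evenTuple_isDehornoyStructure (hk : 2 ≤ k) : (evenTuple k).IsDehornoyStructure where
  admissible := evenTuple_isAdmissible (by omega)
  mul_mem α hα β hβ := by
    have hk0 : 0 < k := by omega
    have h1 := (mem_positives_iff hk hk0 α).1 hα
    have h2 := (mem_positives_iff hk hk0 β).1 hβ
    have h3 := (signedDepth_mul_bounds hk0 α β).2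
    refine (mem_positives_iff hk hk0 _).2 ⟨by omega, fun h => ?_⟩
    -- If `α β = g ∈ G₁`, then `β⁻¹ = g⁻¹ α` is both positive and negative.
    have h4 : β⁻¹ ∈ (evenTuple k).positives := by
      have := mul_mem_positives_of_mem_G₁ hk (inv_mem h) hα
      rwa [mul_inv_rev, inv_mul_cancel_right] at this
    exact Set.disjoint_left.1 (disjoint_positives_negatives hk) h4 hβ
  mul_mul_mem g hg α hα h hh :=
    mem_positives_mul_of_mem_G₁ hk hh (mul_mem_positives_of_mem_G₁ hk hg hα)
  union_eq := by
    have hk0 : 0 < k := by omega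
    ext g
    refine ⟨fun _ => trivial, fun _ => ?_⟩
    by_cases hg : g ∈ (evenTuple k).G₁
    · exact Or.inr hg
    · rcases lt_or_ge 0 (signedDepth hk0 g) with h | h
      · exact Or.inl (Or.inl ((mem_positives_iff hk hk0 g).2 ⟨h, hg⟩))
      · exact Or.inl (Or.inr ((isNegative_iff hk g).2 ⟨h, hg⟩))
  disjoint_pos_neg := disjoint_positives_negatives hk
  disjoint_pos_G₁ := Set.disjoint_left.2 fun g hg =>
    ((mem_positives_iff hk (by omega) g).1 hg).2
  disjoint_neg_G₁ := Set.disjoint_left.2 fun g hg => ((isNegative_iff hk g).1 hg).2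

/-! ### Positive cones -/

lemma isPositiveCone_of_mul_mem {G : Type*} [Group G] {Q : Set G}
    (hmul : ∀ a ∈ Q, ∀ b ∈ Q, a * b ∈ Q) (h1 : (1 : G) ∉ Q)
    (htri : ∀ a, a = 1 ∨ a ∈ Q ∨ a⁻¹ ∈ Q) : IsPositiveCone Q := by
  refine ⟨fun a b => a⁻¹ * b ∈ Q, ?_, fun c a b h => by simpa [mul_assoc] using h,
    fun _ _ => Iff.rfl⟩
  exact
    { trichotomous := fun a b hab hba => by
        rcases htri (a⁻¹ * b) with h | h | h
        · exact inv_mul_eq_one.1 h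
        · exact absurd h hab
        · exact absurd (by simpa using h) hba
      irrefl := fun a h => h1 (by simpa using h)
      trans := fun a b c hab hbc => by simpa [mul_assoc] using hmul _ hab _ hbc }

/-- The elements of a set `Q` that is stable under multiplication by `G₁`, together with a
positive cone of `G₁`, form a positive cone. -/
lemma isPositiveCone_union {G : Type*} [Group G] {Q R : Set G} {K : Subgroup G}
    (hQ : ∀ a ∈ Q, ∀ b ∈ Q, a * b ∈ Q) (hKQ : ∀ a ∈ K, ∀ b ∈ Q, a * b ∈ Q)
    (hQK : ∀ a ∈ Q, ∀ b ∈ K, a * b ∈ Q) (hdisj : ∀ a ∈ Q, a ∉ K)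
    (htri : ∀ a, a ∈ Q ∨ a⁻¹ ∈ Q ∨ a ∈ K) (hRK : R ⊆ K)
    (hR : ∀ a ∈ R, ∀ b ∈ R, a * b ∈ R) (hR1 : (1 : G) ∉ R)
    (hRtri : ∀ a ∈ K, a = 1 ∨ a ∈ R ∨ a⁻¹ ∈ R) : IsPositiveCone (Q ∪ R) := by
  refine isPositiveCone_of_mul_mem ?_ ?_ ?_
  · rintro a (ha | ha) b (hb | hb)
    · exact Or.inl (hQ a ha b hb)
    · exact Or.inl (hQK a ha b (hRK hb))
    · exact Or.inl (hKQ a (hRK ha) b hb)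
    · exact Or.inr (hR a ha b hb)
  · rintro (h | h)
    · exact hdisj 1 h (one_mem K)
    · exact hR1 h
  · intro a
    rcases htri a with h | h | h
    · exact Or.inr (Or.inl (Or.inl h))
    · exact Or.inr (Or.inr (Or.inl h))
    · rcases hRtri a h with h | h | h
      · exact Or.inl h
      · exact Or.inr (Or.inl (Or.inr h))
      · exact Or.inr (Or.inr (Or.inr h))

lemma signedSet_one {G : Type*} [Group G] (P : Set G) : signedSet P 1 = P := by
  ext a
  simp [signedSet]

lemma signedSet_neg_one {G : Type*} [Group G] (P : Set G) : signedSet P (-1) = {a | a⁻¹ ∈ P} := by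
  ext a
  simp [signedSet]

lemma evenTuple_isPositiveCone (hk : 2 ≤ k) (ε₁ ε₂ : ℤˣ) :
    IsPositiveCone (signedSet (evenTuple k).positives ε₁ ∪
      signedSet {g | ∃ n : ℕ, 1 ≤ n ∧ g = genT (2 * k) ^ n} ε₂) := by
  have D := evenTuple_isDehornoyStructure hk
  have htri : ∀ a : DihedralArtin (2 * k), a ∈ (evenTuple k).positives ∨
      a⁻¹ ∈ (evenTuple k).positives ∨ a ∈ (evenTuple k).G₁ := fun a => by
    have : a ∈ (evenTuple k).positives ∪ (evenTuple k).negatives ∪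
        ((evenTuple k).G₁ : Set _) := by rw [D.union_eq]; trivial
    rcases this with (h | h) | h
    · exact Or.inl h
    · refine Or.inr (Or.inl ?_)
      change (evenTuple k).IsNegative a⁻¹⁻¹
      rwa [inv_inv]
    · exact Or.inr (Or.inr h)
  set R : Set (DihedralArtin (2 * k)) := {g | ∃ n : ℕ, 1 ≤ n ∧ g = genT (2 * k) ^ n}
  have hRK : ∀ a ∈ R, a ∈ (evenTuple k).G₁ := by
    rintro _ ⟨n, -, rfl⟩
    exact mem_G₁_iff.2 ⟨n, zpow_natCast _ n⟩
  have hR : ∀ a ∈ R, ∀ b ∈ R, a * b ∈ R := by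
    rintro _ ⟨n, hn, rfl⟩ _ ⟨m, -, rfl⟩
    exact ⟨n + m, by omega, (pow_add _ _ _).symm⟩
  have hR1 : (1 : DihedralArtin (2 * k)) ∉ R := by
    rintro ⟨n, hn, h⟩
    obtain ⟨m, rfl⟩ : ∃ m, n = m + 1 := ⟨n - 1, by omega⟩
    rw [pow_succ] at h
    exact mul_gen_ne_one (pow_mem (gen_mem false) m) false h.symm
  have hRtri : ∀ a ∈ (evenTuple k).G₁, a = 1 ∨ a ∈ R ∨ a⁻¹ ∈ R := by
    intro a ha
    obtain ⟨i, rfl⟩ := mem_G₁_iff.1 ha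
    rcases lt_trichotomy i 0 with hi | rfl | hi
    · obtain ⟨n, rfl⟩ : ∃ n : ℕ, i = -n := ⟨i.natAbs, by omega⟩
      exact Or.inr (Or.inr ⟨n, by omega, by simp [gen]⟩)
    · simp
    · lift i to ℕ using hi.le
      exact Or.inr (Or.inl ⟨i, by omega, by simp [gen]⟩)
  obtain ⟨hQ, hKQ, hQK, hdisj, htri'⟩ : (∀ a ∈ signedSet (evenTuple k).positives ε₁,
      ∀ b ∈ signedSet (evenTuple k).positives ε₁,
        a * b ∈ signedSet (evenTuple k).positives ε₁) ∧
      (∀ a ∈ (evenTuple k).G₁, ∀ b ∈ signedSet (evenTuple k).positives ε₁,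
        a * b ∈ signedSet (evenTuple k).positives ε₁) ∧
      (∀ a ∈ signedSet (evenTuple k).positives ε₁, ∀ b ∈ (evenTuple k).G₁,
        a * b ∈ signedSet (evenTuple k).positives ε₁) ∧
      (∀ a ∈ signedSet (evenTuple k).positives ε₁, a ∉ (evenTuple k).G₁) ∧
      (∀ a, a ∈ signedSet (evenTuple k).positives ε₁ ∨
        a⁻¹ ∈ signedSet (evenTuple k).positives ε₁ ∨ a ∈ (evenTuple k).G₁) := by
    have hd := Set.disjoint_left.1 D.disjoint_pos_G₁
    rcases Int.units_eq_one_or ε₁ with rfl | rfl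
    · rw [signedSet_one]
      exact ⟨D.mul_mem, fun a ha b hb => mul_mem_positives_of_mem_G₁ hk ha hb,
        fun a ha b hb => mem_positives_mul_of_mem_G₁ hk hb ha, fun a ha => hd ha, htri⟩
    · rw [signedSet_neg_one]
      simp only [Set.mem_ofPred_eq, mul_inv_rev, inv_inv]
      refine ⟨fun a ha b hb => D.mul_mem _ hb _ ha,
        fun a ha b hb => mem_positives_mul_of_mem_G₁ hk (inv_mem ha) hb,
        fun a ha b hb => mul_mem_positives_of_mem_G₁ hk (inv_mem hb) ha,
        fun a ha h => hd ha (inv_mem h), fun a => ?_⟩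
      rcases htri a with h | h | h
      · exact Or.inr (Or.inl h)
      · exact Or.inl h
      · exact Or.inr (Or.inr h)
  rcases Int.units_eq_one_or ε₂ with rfl | rfl
  · rw [signedSet_one]
    exact isPositiveCone_union hQ hKQ hQK hdisj htri' hRK hR hR1 hRtri
  · rw [signedSet_neg_one]
    refine isPositiveCone_union hQ hKQ hQK hdisj htri' (fun a ha => ?_) (fun a ha b hb => ?_) ?_
      fun a ha => ?_
    · exact inv_mem_iff.1 (hRK _ ha)
    · rw [Set.mem_ofPred_eq, mul_inv_rev]
      exact hR _ hb _ ha
    · simpa using hR1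
    · rcases hRtri a ha with h | h | h
      · exact Or.inl h
      · exact Or.inr (Or.inr (by simpa using h))
      · exact Or.inr (Or.inl h)

end DehornoyStructures

theorem theorem5p1 (k : ℕ) (hk : 2 ≤ k) :
    (evenTuple k).IsAdmissible ∧
    (evenTuple k).ConditionA (k - 1) ∧
    (evenTuple k).ConditionB (k - 1) ∧
    (evenTuple k).IsDehornoyStructure ∧
    ∀ ε₁ ε₂ : ℤˣ,
      IsPositiveCone
        (signedSet (evenTuple k).positives ε₁ ∪
          signedSet {g | ∃ n : ℕ, 1 ≤ n ∧ g = genT (2 * k) ^ n} ε₂) :=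
  ⟨evenTuple_isAdmissible (by omega), evenTuple_conditionA hk, evenTuple_conditionB hk,
    evenTuple_isDehornoyStructure hk, evenTuple_isPositiveCone hk⟩
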